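/- **Conventions.** $n$ is the security parameter. PPT adversaries are non-uniform: a probabilistic polynomial-time program with an advice string of polynomial length. A *program* may be interactive and keep state during a run, and is always reset between runs. $1/k$ is *inverse polynomial* if $k:\mathbb N\to\mathbb N_{>0}$ is bounded by a polynomial. All algorithms below run in polynomial time and all marks $\tau\in\mathcal M_n$ have polynomial length. **Watermarking algorithms.** $\mathsf{WMSetup}(1^n)\to(\mathsf{sk},\mathsf{xk},\mathsf{mk})$; $\mathsf{Mark}(\mathsf{mk},\mathsf{sk},\tau)\to\mathsf{sk}_\tau$ for $\tau\in\mathcal M_n$; $\mathsf{Extract}_\gamma(\mathsf{xk},C)\to\tau\in\mathcal M_n$ or $\bot$, where $\gamma=1/k$ is the unremovability parameter, given as $1^k$; $\mathsf{Extract}$ only runs the program $C$ as a black box. A watermarkable *weak PRF* has in addition a deterministic $\mathsf{PRF}(\mathsf{sk},\cdot):\{0,1\}^{\ell(n)}\to\{0,1\}^{\ell(n)}$ with $\ell(n)\ge 1$. In its game $G(\mathsf{sk},C)$, a bit $b$ and $x$ are uniform, $y=\mathsf{PRF}(\mathsf{sk},x)$ if $b=0$ and $y$ is uniform if $b=1$;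 $C$ gets $(x,y)$ and an oracle that ignores the query and returns $(x',\mathsf{PRF}(\mathsf{sk},x'))$ for a fresh uniform $x'$; $C$ wins if it outputs $b$. A watermarkable *SKE* has in addition randomized $\mathsf{Enc}(\mathsf{sk},m)$ and deterministic $\mathsf{Dec}(\mathsf{sk},\mathsf{ct})$ for $m\in\{0,1\}^{\ell(n)}$. In its (CPA) game $G(\mathsf{sk},C)$, $C$ has the oracle $\mathsf{Enc}(\mathsf{sk},\cdot)$ throughout, submits $(m_0,m_1)$ once, gets $\mathsf{Enc}(\mathsf{sk},m_b)$ for a uniform bit $b$, and wins if it outputs $b$. The view of $C$ consists of its input, its queries with their answers, and its output. $C$ is *$\gamma$-good* for $\mathsf{sk}$ if $\Pr[C\text{ wins }G(\mathsf{sk},C)]\ge\frac12+\gamma$. **Security.** Let $q:\mathbb N\to\{1,2,\dots\}\cup\{\infty\}$. A watermarkable weak PRF or SKE is *secure with $q$ marking queries and private (resp. public) extraction* if the following hold, where in the public case adversaries also get $\mathsf{xk}$ as input: 1. *Functionality preserving.* For a negligible $\varepsilon$ and all $n$, $\tau\in\mathcal M_n$, with $(\mathsf{sk},\mathsf{xk},\mathsf{mk})\gets\mathsf{WMSetup}(1^n)$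 and $\mathsf{sk}_\tau\gets\mathsf{Mark}(\mathsf{mk},\mathsf{sk},\tau)$. Weak PRF: for all $x$, $\Pr[\mathsf{PRF}(\mathsf{sk}_\tau,x)=\mathsf{PRF}(\mathsf{sk},x)]\ge1-\varepsilon(n)$. SKE: for all $m$, $\Pr[\mathsf{Dec}(\mathsf{sk}_\tau,\mathsf{ct}')=m\wedge\mathsf{Dec}(\mathsf{sk},\mathsf{ct})=m]\ge1-\varepsilon(n)$ for $\mathsf{ct}\gets\mathsf{Enc}(\mathsf{sk},m)$, $\mathsf{ct}'\gets\mathsf{Enc}(\mathsf{sk}_\tau,m)$; and for all $c$, $\Pr[\mathsf{Dec}(\mathsf{sk}_\tau,c)=\mathsf{Dec}(\mathsf{sk},c)]\ge1-\varepsilon(n)$. 2. *Correctness of extraction.* There is a polynomial-time algorithm $T$ such that for every inverse polynomial $\gamma<\frac12$ there is a negligible $\varepsilon$ with $\Pr[\mathsf{Extract}_\gamma(\mathsf{xk},T(1^n,\mathsf{sk}_\tau,\cdot))=\tau]\ge1-\varepsilon(n)$ for all $n$, $\tau\in\mathcal M_n$. 3. *Security with the game.* Every PPT adversary wins $G(\mathsf{sk},\cdot)$,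 $\mathsf{sk}$ from $\mathsf{WMSetup}(1^n)$, with probability at most $\frac12+\mathrm{negl}(n)$. 4. *Strong unremovability.* The scheme is $\gamma$-unremovable for every inverse polynomial $\gamma$, where *$\gamma$-unremovable* means: for every PPT adversary that outputs a program $C$ after at most $q(n)$ queries to $\mathsf{Mark}(\mathsf{mk},\mathsf{sk},\cdot)$ (with $\mathcal Q$ the set of marks queried) and every polynomial $p$, $\Pr[\mathsf{Extract}_\gamma(\mathsf{xk},C)\notin\mathcal Q\wedge C\text{ runs in time }p\wedge C\text{ is }\gamma\text{-good for }\mathsf{sk}]\le\mathrm{negl}(n)$. 5. *Simulation by the extraction key.* There is a polynomial-time black-box simulator $\mathsf{Sim}$ such that for every PPT adversary that outputs polynomial-time programs $C$ (after queries to the PRF-sample oracle, resp. to $\mathsf{Enc}(\mathsf{sk},\cdot)$), the view of $C$ in $G(\mathsf{sk},C)$ and $\mathsf{Sim}^{C}(\mathsf{xk})$ are indistinguishable: perfectly, statistically or computationally, as specified. *Single-key* security is the case $q=1$; *collusion resistance* is the case $q=\infty$. *Meaningfulness*: for every polynomial-time program $T$ that has black-box access to $\mathsf{PRF}(\mathsf{sk},\cdot)$,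 resp. $\mathsf{Dec}(\mathsf{sk},\cdot)$, for the unmarked $\mathsf{sk}$, and every inverse polynomial $\gamma$, $\Pr[\mathsf{Extract}_\gamma(\mathsf{xk},T^{\mathsf{sk}})\ne\bot]\le\mathrm{negl}(n)$. **Construction.** Given a watermarkable weak PRF, keep $\mathsf{WMSetup}$, $\mathsf{Mark}$, $\ell$ and the marks, and put $$\mathsf{Enc}(\mathsf{sk},m)=(r,\mathsf{PRF}(\mathsf{sk},r)\oplus m)\ \text{ with }r\gets\{0,1\}^{\ell(n)},\qquad \mathsf{Dec}(\mathsf{sk},(r,c))=\mathsf{PRF}(\mathsf{sk},r)\oplus c,$$ $$\mathsf{Extract}^{\mathsf{SKE}}_\gamma(\mathsf{xk},C)=\mathsf{Extract}^{\mathsf{PRF}}_{\gamma/2}(\mathsf{xk},C_{\mathsf{PRF}}),$$ where $C_{\mathsf{PRF}}$, on a challenge $(r^*,y^*)$, picks a uniform bit $b$ and runs $C$, answers each encryption query $m$ of $C$ by $(r,y\oplus m)$ with $(r,y)$ from its own oracle, answers $(m_0,m_1)$ by $(r^*,y^*\oplus m_b)$, and outputs $0$ if $C$ outputs $b$ and $1$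 otherwise. **Lemma.** Let $q\ge1$. If the watermarkable weak PRF is secure with $q$ marking queries and public (resp. private) extraction, then the constructed scheme is a watermarkable CPA-secure SKE that is secure with $q$ marking queries and public (resp. private) extraction, with the same (perfect, statistical or computational) quality of the simulation. In particular, this holds for collusion-resistant ($q=\infty$) and for single-key ($q=1$) security. Moreover, $\gamma/2$-unremovability of the weak PRF implies $\gamma$-unremovability of the SKE for each $\gamma=1/k$, and meaningfulness of the weak PRF implies meaningfulness of the SKE. -/

import Mathlib

open Filter

noncomputable section

namespace WM

/-! ### Data -/

/-- All data (keys, messages, marks, programs) are binary trees; a bit string is a list of bits. -/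
inductive Val where
  | leaf : Val
  | node : Val → Val → Val

namespace Val

def size : Val → ℕ
  | leaf => 1
  | node a b => a.size + b.size + 1

def left : Val → Val
  | leaf => leaf
  | node a _ => a

def right : Val → Val
  | leaf => leaf
  | node _ b => b

/-- Length of a tree read as a list. -/
def len : Val → ℕ
  | leaf => 0
  | node _ b => b.len + 1

def toBool : Val → Bool
  | leaf => false
  | node _ _ => true

def bit : Bool → Val
  | false => leaf
  | true => node leaf leaf

def ofList : List Val → Val
  | [] => leaf
  | a :: l => node a (ofList l)

/-- The unary encoding `1^n`. -/
def unary (n : ℕ) : Val := ofList (List.replicate n leaf)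

/-- The encoding of an `l`-bit string. -/
def ofBits {l : ℕ} (x : Fin l → Bool) : Val := ofList (List.ofFn fun i => bit (x i))

/-- Any tree is read as an `l`-bit string (truncated, or padded with zeros). -/
def toBits (l : ℕ) (v : Val) : Fin l → Bool := fun i => ((right^[i.1]) v).left.toBool

/-- Bitwise exclusive or; the result has the length of the first argument. -/
def xorVal : Val → Val → Val
  | leaf, _ => leaf
  | node a y, m => node (bit (a.toBool ^^ m.left.toBool)) (xorVal y m.right)

/-- `leaf` encodes `⊥`, and `node _ t` encodes the value `t`. -/
def toOption : Val → Option Val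
  | leaf => none
  | node _ t => some t

end Val

open Val

/-! ### Randomised interactive computations -/

/-- A randomised interactive computation: it tosses coins, sends messages (`call`) to its
environment and waits for the answers, spends time (`tick`), and returns a result. -/
inductive Comp (α : Type) : Type where
  | ret : α → Comp α
  | flip : (Bool → Comp α) → Comp α
  | call : Val → (Val → Comp α) → Comp α
  | tick : ℕ → Comp α → Comp α

namespace Comp

def bind {α β : Type} : Comp α → (α → Comp β) → Comp β
  | ret a, f => f a
  | flip k, f => flip fun b => (k b).bind f
  | call q k, f => call q fun a => (k a).bind f
  | tick c m, f => tick c (m.bind f)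

/-- Forget the time spent. -/
def erase {α : Type} : Comp α → Comp α
  | ret a => ret a
  | flip k => flip fun b => (k b).erase
  | call q k => call q fun a => (k a).erase
  | tick _ m => m.erase

/-- Run a computation while answering its calls by a stateful handler, which may itself call. -/
def simulate {σ α : Type} (h : σ → Val → Comp (Val × σ)) : Comp α → σ → Comp (α × σ)
  | ret a, s => ret (a, s)
  | flip k, s => flip fun b => (k b).simulate h s
  | call q k, s => (h s q).bind fun r => (k r.1).simulate h r.2
  | tick c m, s => tick c (m.simulate h s)

/-- The result of a computation whose calls are answered by a stateful randomised oracle. -/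
def runOracle {σ α : Type} (O : σ → Val → PMF (Val × σ)) : Comp α → σ → PMF (α × σ)
  | ret a, s => PMF.pure (a, s)
  | flip k, s => (PMF.uniformOfFintype Bool).bind fun b => (k b).runOracle O s
  | call q k, s => (O s q).bind fun r => (k r.1).runOracle O r.2
  | tick _ m, s => m.runOracle O s

/-- The result of a computation that has no oracle (calls are answered by `leaf`). -/
def dist {α : Type} : Comp α → PMF α
  | ret a => PMF.pure a
  | flip k => (PMF.uniformOfFintype Bool).bind fun b => (k b).dist
  | call _ k => (k leaf).dist
  | tick _ m => m.dist

/-- For all coins and all answers of size at most `s`, the computation takes time at most `t`, where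
a coin toss takes time one, and writing a message or the result takes time its size. -/
def WithinTime (s : ℕ) : Comp Val → ℕ → Prop
  | ret v, t => v.size ≤ t
  | flip k, t => 1 ≤ t ∧ ∀ b, (k b).WithinTime s (t - 1)
  | call q k, t => q.size ≤ t ∧ ∀ a : Val, a.size ≤ s → (k a).WithinTime s (t - q.size)
  | tick c m, t => c ≤ t ∧ m.WithinTime s (t - c)

end Comp

/-- An interactive program, seen from outside: on an input it starts a computation. -/
abbrev Behaviour := Val → Comp Val

/-- The program runs in time `p`, at security parameter `n`, as a function of the largest
message it receives. -/
def Bounded (ρ : Behaviour) (p : Polynomial ℕ) (n : ℕ) : Prop :=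
  ∀ (s : ℕ) (x : Val), x.size ≤ s → (ρ x).WithinTime s (p.eval (n + s))

/-! ### Programs -/

/-- The programming language (loop programs over trees). Besides the data operations there are
coin tosses (`flip`), messages to the environment (`call`), running a program as a subroutine
whose messages are answered by another program (`sim`), and, for algorithms that have black-box
access to a program, running that program (`subj`). -/
inductive Code where
  | nil : Code
  | id : Code
  | fst : Code
  | snd : Code
  | pair : Code → Code → Code
  | comp : Code → Code → Code
  | cond : Code → Code → Code
  | loop : Code → Code
  | flip : Code
  | call : Code
  | sim : Code → Code → Code
  | subj : Code

namespace Code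

/-- Semantics of programs; `ρ` is the program to which black-box access is given. Every
instruction is charged at least the size of the data it is applied to.
`comp c d` runs `d`, then `c`; `cond c d` branches on whether the first component is `leaf`;
`loop c` on `(a, x)` iterates `c` on `x`, as often as the list `a` is long;
`sim c h` on `(s, x)` runs `c` on `x`, and answers each message `m` of `c` by running `h` on
`(s, m)`, which gives the new state `s` and the answer. -/
def eval (ρ : Behaviour) : Code → Behaviour
  | nil => fun v => .tick (v.size + 1) (.ret leaf)
  | id => fun v => .tick (v.size + 1) (.ret v)
  | fst => fun v => .tick (v.size + 1) (.ret v.left)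
  | snd => fun v => .tick (v.size + 1) (.ret v.right)
  | pair c d => fun v => .tick (v.size + 1)
      ((c.eval ρ v).bind fun a => (d.eval ρ v).bind fun b => .ret (node a b))
  | comp c d => fun v => .tick (v.size + 1) ((d.eval ρ v).bind (c.eval ρ))
  | cond c d => fun v => .tick (v.size + 1)
      (match v.left with
        | leaf => c.eval ρ v
        | node _ _ => d.eval ρ v)
  | loop c => fun v => .tick (v.size + 1)
      ((fun m : Comp Val => m.bind (c.eval ρ))^[v.left.len] (.ret v.right))
  | flip => fun v => .tick (v.size + 1) (.flip fun b => .ret (bit b))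
  | call => fun v => .tick (v.size + 1) (.call v fun a => .tick a.size (.ret a))
  | sim c h => fun v => .tick (v.size + 1)
      (((c.eval ρ v.right).simulate
        (fun s m => (h.eval ρ (node s m)).bind fun r => .ret (r.right, r.left)) v.left).bind
        fun r => .ret (node r.2 r.1))
  | subj => fun v => .tick (v.size + 1) (ρ v)

/-- Programs as data. -/
def encode : Code → Val
  | nil => node (unary 0) (node leaf leaf)
  | id => node (unary 1) (node leaf leaf)
  | fst => node (unary 2) (node leaf leaf)
  | snd => node (unary 3) (node leaf leaf)
  | pair c d => node (unary 4) (node c.encode d.encode)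
  | comp c d => node (unary 5) (node c.encode d.encode)
  | cond c d => node (unary 6) (node c.encode d.encode)
  | loop c => node (unary 7) (node c.encode leaf)
  | flip => node (unary 8) (node leaf leaf)
  | call => node (unary 9) (node leaf leaf)
  | sim c h => node (unary 10) (node c.encode h.encode)
  | subj => node (unary 11) (node leaf leaf)

/-- Every tree is read as a program. -/
def decode : Val → Code
  | node t (node a b) =>
    match t.len with
    | 1 => id
    | 2 => fst
    | 3 => snd
    | 4 => pair (decode a) (decode b)
    | 5 => comp (decode a) (decode b)
    | 6 => cond (decode a) (decode b)
    | 7 => loop (decode a)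
    | 8 => flip
    | 9 => call
    | 10 => sim (decode a) (decode b)
    | 11 => subj
    | _ => nil
  | _ => nil

theorem decode_encode (c : Code) : decode c.encode = c := by
  induction c <;> simp_all [encode, decode, unary, ofList, len, List.replicate]

end Code

/-- No black-box access. -/
def noSubj : Behaviour := fun _ => .ret leaf

/-- A program whose running time is polynomial in the length of its input and of the longest
message that it receives. -/
def Code.PolyTime (c : Code) : Prop :=
  ∃ p : Polynomial ℕ, ∀ (s : ℕ) (v : Val),
    (c.eval noSubj v).WithinTime s (p.eval (v.size + s))

/-- A program with black-box access to another program, given `1^n` and a further input, runs in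
polynomial time whenever that other program does. -/
def Code.BlackBoxPolyTime (c : Code) : Prop :=
  ∀ p : Polynomial ℕ, ∃ p' : Polynomial ℕ, ∀ (n : ℕ) (ρ : Behaviour), Bounded ρ p n →
    ∀ v : Val, (c.eval ρ (node (unary n) v)).WithinTime 1 (p'.eval (n + v.size))

/-- The program described by the data `D = (code, hardwired input)`. -/
def Val.exec (D : Val) : Behaviour := fun x => (Code.decode D.left).eval noSubj (node D.right x)

/-- The program `T(n, w, ·)` with the hardwired input `w`. -/
def hardwire (T : Code) (n : ℕ) (w : Val) : Val := node T.encode (node (unary n) w)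

/-- A randomised function (`f i` is the distribution of the result on `input i`) is computable in
polynomial time. -/
def PPTComputable {ι : Type} (input : ι → Val) (f : ι → PMF Val) : Prop :=
  ∃ c : Code, c.PolyTime ∧ ∀ i, (c.eval noSubj (input i)).dist = f i

def PolyBounded (f : ℕ → ℕ) : Prop := ∃ p : Polynomial ℕ, ∀ n, f n ≤ p.eval n

/-- A (non-uniform) PPT adversary. -/
structure Adversary where
  code : Code
  polyTime : code.PolyTime
  advice : ℕ → Val
  advice_poly : PolyBounded fun n => (advice n).size

/-- The adversary on input `1^n`, its advice, and `aux`. -/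
def Adversary.run (A : Adversary) (n : ℕ) (aux : Val) : Comp Val :=
  A.code.eval noSubj (node (node (unary n) (A.advice n)) aux)

/-! ### Probabilities -/

def prob (X : PMF Prop) : ℝ := (X True).toReal

def Negligible (ε : ℕ → ℝ) : Prop :=
  Asymptotics.SuperpolynomialDecay atTop (fun n : ℕ => (n : ℝ)) ε

def uniformBits (l : ℕ) : PMF (Fin l → Bool) := PMF.uniformOfFintype (Fin l → Bool)

inductive SimQuality where
  | perfect
  | statistical
  | computational

/-- Indistinguishability of two families of distributions. -/
def Indist (X Y : ℕ → PMF Val) : SimQuality → Prop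
  | .perfect => X = Y
  | .statistical => ∃ ε, Negligible ε ∧ ∀ n, ∀ E : Set Val,
      |((X n).toOuterMeasure E).toReal - ((Y n).toOuterMeasure E).toReal| ≤ ε n
  | .computational => ∀ Z : Adversary, ∃ ε, Negligible ε ∧ ∀ n,
      |prob ((X n).bind fun v => (Z.run n v).dist.map fun g => g.toBool = true) -
        prob ((Y n).bind fun v => (Z.run n v).dist.map fun g => g.toBool = true)| ≤ ε n

/-! ### Watermarkable implementations -/

/-- The watermarking algorithms, as far as they have the same form for all primitives. -/
structure Scheme where
  /-- the mark space -/
  marks : ℕ → Set Val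
  /-- `WMSetup(1^n)`, with result `(sk, xk, mk)` -/
  setup : ℕ → PMF (Val × Val × Val)
  /-- `Mark(mk, sk, τ)` at security parameter `n` -/
  mark : ℕ → Val → Val → Val → PMF Val
  /-- `Extract(xk, C)` at security parameter `n` and unremovability parameter `γ = 1 / k` (`n` and
  `k` are the first two arguments); the result is a mark or `⊥` (`none`) -/
  extract : ℕ → ℕ → Val → Behaviour → PMF (Option Val)
  extract_range : ∀ n k xk C τ, some τ ∈ (extract n k xk C).support → τ ∈ marks n

/-- The security game of a primitive, given `n` and the secret key. The trivial success probability
is `1 / 2` for both primitives below. -/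
structure Game where
  /-- the (second stage of the) game: whether the program, as adversary, wins -/
  win : ℕ → Val → Behaviour → PMF Prop
  /-- the view of the program in the (second stage of the) game, including its output -/
  view : ℕ → Val → Behaviour → PMF Val
  /-- the oracle of the first stage -/
  oracle : ℕ → Val → Val → PMF Val
  /-- the deterministic algorithm that uses the secret key -/
  secEval : ℕ → Val → Val → Val

/-- The extraction key is given to the adversary if and only if extraction is public. -/
def pubInfo (pub : Bool) (xk : Val) : Val := if pub then xk else leaf

/-- Security with the game: no PPT adversary wins noticeably better than by guessing. -/
def GameSecure (S : Scheme) (G : Game) (pub : Bool) : Prop :=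
  ∀ A : Adversary, ∃ ε, Negligible ε ∧ ∀ n,
    prob ((S.setup n).bind fun key =>
      G.win n key.1 fun chal => A.run n (node (pubInfo pub key.2.1) chal)) ≤ 1 / 2 + ε n

open Classical in
/-- The marking oracle, which answers at most `q n` queries. The state is the list of the marks
queried so far. -/
def markOracle (S : Scheme) (q : ℕ → ℕ∞) (n : ℕ) (mk sk : Val) (Q : List Val) (τ : Val) :
    PMF (Val × List Val) :=
  if τ ∈ S.marks n ∧ (Q.length : ℕ∞) < q n then (S.mark n mk sk τ).map fun k => (k, τ :: Q)
  else PMF.pure (leaf, Q)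

/-- The program wins the game with probability at least `1 / 2 + 1 / k`. -/
def Good (G : Game) (n k : ℕ) (sk : Val) (C : Behaviour) : Prop :=
  1 / 2 + 1 / (k : ℝ) ≤ prob (G.win n sk C)

/-- `γ`-unremovability for `γ(n) = 1 / k(n)`, with at most `q n` marking queries: for every PPT
adversary and every polynomial time bound `p` on its pirate programs, the probability that the
pirate program is `γ`-good although no queried mark is extracted from it is negligible. -/
def Unremovable (S : Scheme) (G : Game) (pub : Bool) (q : ℕ → ℕ∞) (k : ℕ → ℕ) : Prop :=
  ∀ (A : Adversary) (p : Polynomial ℕ), ∃ ε, Negligible ε ∧ ∀ n,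
    prob ((S.setup n).bind fun key =>
      ((A.run n (pubInfo pub key.2.1)).runOracle (markOracle S q n key.2.2 key.1) []).bind fun r =>
        (S.extract n (k n) key.2.1 fun x => (r.1.exec x).erase).map fun out =>
          (¬ ∃ τ ∈ r.2, out = some τ) ∧ Bounded r.1.exec p n ∧ Good G n (k n) key.1 r.1.exec)
      ≤ ε n

/-- Strong unremovability: `γ`-unremovability for every inverse polynomial `γ`. -/
def StronglyUnremovable (S : Scheme) (G : Game) (pub : Bool) (q : ℕ → ℕ∞) : Prop :=
  ∀ k : ℕ → ℕ, PolyBounded k → (∀ n, 0 < k n) → Unremovable S G pub q k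

/-- Correctness of extraction, for every inverse polynomial `γ = 1 / k < 1 / 2`. -/
def ExtractionCorrect (S : Scheme) : Prop :=
  ∃ T : Code, T.PolyTime ∧ ∀ k : ℕ → ℕ, PolyBounded k → (∀ n, 2 < k n) →
    ∃ ε, Negligible ε ∧ ∀ n, ∀ τ ∈ S.marks n,
      1 - ε n ≤ prob ((S.setup n).bind fun key => (S.mark n key.2.2 key.1 τ).bind fun skt =>
        (S.extract n (k n) key.2.1 fun x => ((hardwire T n skt).exec x).erase).map fun out =>
          out = some τ)

/-- The first stage of the game: the adversary, with its oracle, outputs a program. -/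
def stageOne (G : Game) (A : Adversary) (n : ℕ) (sk aux : Val) : PMF Val :=
  ((A.run n aux).runOracle (fun (_ : Unit) m => (G.oracle n sk m).map fun a => (a, ())) ()).map
    Prod.fst

/-- The simulation property of the extraction key: from the extraction key, and with black-box
access to the second stage adversary, its view in the game can be simulated. -/
def KeySimulation (S : Scheme) (G : Game) (pub : Bool) (quality : SimQuality) : Prop :=
  ∃ Sim : Code, Sim.BlackBoxPolyTime ∧ ∀ A : Adversary,
    (∃ p : Polynomial ℕ, ∀ n, ∀ key ∈ (S.setup n).support,
      ∀ D ∈ (stageOne G A n key.1 (pubInfo pub key.2.1)).support, Bounded D.exec p n) →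
    Indist
      (fun n => (S.setup n).bind fun key =>
        (stageOne G A n key.1 (pubInfo pub key.2.1)).bind fun D => G.view n key.1 D.exec)
      (fun n => (S.setup n).bind fun key =>
        (stageOne G A n key.1 (pubInfo pub key.2.1)).bind fun D =>
          (Sim.eval D.exec (node (unary n) key.2.1)).dist)
      quality

/-- The program `T` with the unmarked key `sk` built in, which it uses only to evaluate: a message
with first component `leaf` is sent on to the game, any other message is answered by the
evaluation algorithm with key `sk`. -/
def keyed (G : Game) (T : Code) (n : ℕ) (sk : Val) : Behaviour := fun chal =>
  ((T.eval noSubj (node (unary n) chal)).simulate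
    (fun (_ : Unit) m =>
      if m.left.toBool then .ret (G.secEval n sk m.right, ())
      else .call m.right fun a => .ret (a, ())) ()).bind fun r => .ret r.1

/-- Meaningfulness: no mark is extracted from a program with an unmarked key. -/
def Meaningful (S : Scheme) (G : Game) : Prop :=
  ∀ T : Code, T.PolyTime → ∀ k : ℕ → ℕ, PolyBounded k → (∀ n, 0 < k n) →
    ∃ ε, Negligible ε ∧ ∀ n,
      prob ((S.setup n).bind fun key =>
        (S.extract n (k n) key.2.1 fun x => (keyed G T n key.1 x).erase).map fun out =>
          out ≠ none) ≤ ε n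

/-- The marks are short, setup and marking run in polynomial time, and extraction is a polynomial
time algorithm (in `n` and `k`) that only runs the given program as a black box. -/
def Scheme.Efficient (S : Scheme) : Prop :=
  (∃ p : Polynomial ℕ, ∀ n, ∀ τ ∈ S.marks n, τ.size ≤ p.eval n) ∧
  PPTComputable unary (fun n => (S.setup n).map fun key => node key.1 (node key.2.1 key.2.2)) ∧
  PPTComputable
    (fun i : {i : ℕ × Val × Val × Val // i.2.2.2 ∈ S.marks i.1} =>
      node (unary i.1.1) (node i.1.2.1 (node i.1.2.2.1 i.1.2.2.2)))
    (fun i => S.mark i.1.1 i.1.2.1 i.1.2.2.1 i.1.2.2.2) ∧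
  ∃ E : Code, E.BlackBoxPolyTime ∧ ∀ (n k : ℕ) (xk : Val) (C : Behaviour),
    ((E.eval C (node (unary n) (node (unary k) xk))).dist).map toOption =
      S.extract n k xk fun x => (C x).erase

/-! ### Watermarkable weak PRFs -/

/-- A watermarkable implementation of a weak PRF: syntax. Inputs and outputs at security parameter
`n` have `len n` bits. -/
structure WMPRF extends Scheme where
  len : ℕ → ℕ
  len_pos : ∀ n, 0 < len n
  eval : (n : ℕ) → Val → (Fin (len n) → Bool) → (Fin (len n) → Bool)

/-- An oracle that keeps a log of its queries and answers (the latest first). -/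
def logged (O : Val → PMF Val) (log q : Val) : PMF (Val × Val) :=
  (O q).map fun a => (a, node (node q a) log)

namespace WMPRF

variable (W : WMPRF)

/-- The oracle of the weak PRF game: it ignores the query, and returns `(x, PRF(sk, x))` for a
fresh random `x`. -/
def sample (n : ℕ) (sk : Val) (_ : Val) : PMF Val :=
  (uniformBits (W.len n)).map fun x => node (ofBits x) (ofBits (W.eval n sk x))

/-- The weak PRF game: the program gets `(x, y)` with `y = PRF(sk, x)` (if `b = 0`) or `y` random
(if `b = 1`) for a random `x`. The result is the bit `b`, the challenge `(x, y)`, the output of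
the program, and the log of its oracle queries. -/
def experiment (n : ℕ) (sk : Val) (C : Behaviour) : PMF (Bool × Val × Val × Val) :=
  (PMF.uniformOfFintype Bool).bind fun b =>
  (uniformBits (W.len n)).bind fun x =>
  (uniformBits (W.len n)).bind fun z =>
    let chal := node (ofBits x) (ofBits (if b then z else W.eval n sk x))
    ((C chal).runOracle (logged (W.sample n sk)) leaf).map fun r => (b, chal, r.1, r.2)

def game : Game where
  win n sk C := (W.experiment n sk C).map fun e => e.2.2.1.toBool = e.1
  view n sk C := (W.experiment n sk C).map fun e => node e.2.1 (node e.2.2.2 e.2.2.1)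
  oracle n sk := W.sample n sk
  secEval n sk v := ofBits (W.eval n sk (toBits (W.len n) v))

/-- Functionality preserving. -/
def FunctionalityPreserving : Prop :=
  ∃ ε, Negligible ε ∧ ∀ (n : ℕ) (x : Fin (W.len n) → Bool), ∀ τ ∈ W.marks n,
    1 - ε n ≤ prob ((W.setup n).bind fun key => (W.mark n key.2.2 key.1 τ).map fun skt =>
      W.eval n skt x = W.eval n key.1 x)

/-- All algorithms are efficient. -/
def Efficient : Prop :=
  W.toScheme.Efficient ∧
  PPTComputable unary (fun n => PMF.pure (unary (W.len n))) ∧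
  PPTComputable
    (fun i : (n : ℕ) × Val × (Fin (W.len n) → Bool) =>
      node (unary i.1) (node i.2.1 (ofBits i.2.2)))
    (fun i => PMF.pure (ofBits (W.eval i.1 i.2.1 i.2.2)))

/-- `W` is a secure watermarkable implementation of a weak PRF, with public extraction if `pub` and
private extraction otherwise, for up to `q n` marking queries (`q = 1` is single-key security,
`q = ⊤` is collusion resistance). -/
def Secure (pub : Bool) (q : ℕ → ℕ∞) (quality : SimQuality) : Prop :=
  W.Efficient ∧ W.FunctionalityPreserving ∧ ExtractionCorrect W.toScheme ∧
  GameSecure W.toScheme W.game pub ∧ StronglyUnremovable W.toScheme W.game pub q ∧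
  KeySimulation W.toScheme W.game pub quality

end WMPRF

/-! ### Watermarkable CPA-secure secret key encryption -/

/-- A watermarkable implementation of secret key encryption: syntax. Messages at security parameter
`n` have `len n` bits. -/
structure WMSKE extends Scheme where
  len : ℕ → ℕ
  enc : (n : ℕ) → Val → (Fin (len n) → Bool) → PMF Val
  dec : (n : ℕ) → Val → Val → (Fin (len n) → Bool)

namespace WMSKE

variable (S : WMSKE)

/-- Encryption of an arbitrary tree, read as a message. -/
def encVal (n : ℕ) (sk v : Val) : PMF Val := S.enc n sk (toBits (S.len n) v)

/-- The oracle of the CPA game with bit `b`. A query `(leaf, m)` asks for an encryption of `m`. The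
first query of any other form `(_, (m₀, m₁))` submits the challenge messages and is answered by an
encryption of `m_b`; later ones are answered by `leaf`. The state records whether the challenge
messages were submitted, and the log of the queries and answers. -/
def challenger (n : ℕ) (sk : Val) (b : Bool) (s : Bool × Val) (q : Val) :
    PMF (Val × (Bool × Val)) :=
  (if q.left.toBool = false then S.encVal n sk q.right
    else if s.1 then PMF.pure leaf
    else S.encVal n sk (if b then q.right.right else q.right.left)).map
    fun a => (a, (s.1 || q.left.toBool, node (node q a) s.2))

/-- The CPA game: the result is the bit `b`, the output of the program, and the log. -/
def experiment (n : ℕ) (sk : Val) (C : Behaviour) : PMF (Bool × Val × Val) :=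
  (PMF.uniformOfFintype Bool).bind fun b =>
    ((C leaf).runOracle (S.challenger n sk b) (false, leaf)).map fun r => (b, r.1, r.2.2)

def game : Game where
  win n sk C := (S.experiment n sk C).map fun e => e.2.1.toBool = e.1
  view n sk C := (S.experiment n sk C).map fun e => node e.2.2 e.2.1
  oracle n sk := S.encVal n sk
  secEval n sk c := ofBits (S.dec n sk c)

/-- Correctness and functionality preserving: original and marked keys decrypt what they encrypted;
and (exactness) a marked key decrypts every string like the original key. -/
def FunctionalityPreserving : Prop :=
  ∃ ε, Negligible ε ∧ ∀ n, ∀ τ ∈ S.marks n,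
    (∀ m : Fin (S.len n) → Bool,
      1 - ε n ≤ prob ((S.setup n).bind fun key => (S.mark n key.2.2 key.1 τ).bind fun skt =>
        (S.enc n key.1 m).bind fun c => (S.enc n skt m).map fun c' =>
          S.dec n skt c' = m ∧ S.dec n key.1 c = m)) ∧
    ∀ c : Val,
      1 - ε n ≤ prob ((S.setup n).bind fun key => (S.mark n key.2.2 key.1 τ).map fun skt =>
        S.dec n skt c = S.dec n key.1 c)

/-- All algorithms are efficient. -/
def Efficient : Prop :=
  S.toScheme.Efficient ∧
  PPTComputable unary (fun n => PMF.pure (unary (S.len n))) ∧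
  PPTComputable
    (fun i : (n : ℕ) × Val × (Fin (S.len n) → Bool) =>
      node (unary i.1) (node i.2.1 (ofBits i.2.2)))
    (fun i => S.enc i.1 i.2.1 i.2.2) ∧
  PPTComputable
    (fun i : ℕ × Val × Val => node (unary i.1) (node i.2.1 i.2.2))
    (fun i => PMF.pure (ofBits (S.dec i.1 i.2.1 i.2.2)))

/-- `S` is a secure watermarkable implementation of CPA-secure secret key encryption, with public
extraction if `pub` and private extraction otherwise, for up to `q n` marking queries. -/
def Secure (pub : Bool) (q : ℕ → ℕ∞) (quality : SimQuality) : Prop :=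
  S.Efficient ∧ S.FunctionalityPreserving ∧ ExtractionCorrect S.toScheme ∧
  GameSecure S.toScheme S.game pub ∧ StronglyUnremovable S.toScheme S.game pub q ∧
  KeySimulation S.toScheme S.game pub quality

end WMSKE

/-! ### The construction -/

/-- How the reduction with challenge `chal = (r, y)` and bit `b` answers a query of the CPA
adversary; `used` records whether the challenge messages were submitted. -/
def reduceStep (b : Bool) (chal : Val) (used : Bool) (q : Val) : Comp (Val × Bool) :=
  if q.left.toBool = false then
    .call leaf fun a => .ret (node a.left (xorVal a.right q.right), used)
  else if used then .ret (leaf, true)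
  else .ret (node chal.left
    (xorVal chal.right (if b then q.right.right else q.right.left)), true)

/-- The stage-2 reduction: it turns an adversary `C` of the CPA game into an adversary of the weak
PRF game, which on a challenge `(r, y)` chooses a random bit `b`, runs `C`, answers encryption
queries `m` by `(r', y' ⊕ m)` with `(r', y')` from its oracle, answers the challenge messages by
`(r, y ⊕ m_b)`, and outputs `0` if `C` outputs `b` and `1` otherwise. -/
def reduce (C : Behaviour) : Behaviour := fun chal =>
  .flip fun b => ((C leaf).simulate (reduceStep b chal) false).bind fun r =>
    .ret (bit (r.1.toBool ^^ b))

/-- The watermarkable encryption scheme built from a watermarkable weak PRF: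
`Enc(sk, m) = (r, PRF(sk, r) ⊕ m)`, and a mark is extracted from `C` by running the extraction
algorithm of the weak PRF, with unremovability parameter `γ / 2`, on the reduction with `C`. -/
def WMPRF.toCPA (W : WMPRF) : WMSKE where
  marks := W.marks
  setup := W.setup
  mark := W.mark
  extract n k xk C := W.extract n (2 * k) xk (reduce C)
  extract_range n k xk C := W.extract_range n (2 * k) xk (reduce C)
  len := W.len
  enc n sk m := (uniformBits (W.len n)).map fun r =>
    node (ofBits r) (ofBits fun i => W.eval n sk r i ^^ m i)
  dec n sk c := fun i =>
    W.eval n sk (toBits (W.len n) c.left) i ^^ toBits (W.len n) c.right i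

end WM

end

/-!
The SKE scheme inherits every property from the weak PRF through black-box reductions, so the proof
has a probabilistic part, which compares the two games, and a computational part, which writes the
reductions in the programming language and bounds their running times.

*The games.* `reduce C` wins the weak PRF game with probability `w / 2 + 1 / 4`, where `w` is the
probability that `C` wins the CPA game (`prob_win_reduce`). Indeed, the challenge `(r, y)` is used at
most once, so it may be drawn at the moment when it is used (`bind_runOracle_eager`). A pseudorandom
challenge is then an honest encryption of `m_b`, and a random one is a one-time pad that hides `b`
(`challenge_true_map_encAnswer`). Hence a CPA program that is `γ`-good gives a weak PRF program that
is `γ / 2`-good (`good_reduce`); as `Extract` of the SKE runs `Extract` of the weak PRF on exactly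
this program, unremovability is inherited (`unremovable_toCPA`), and so is security with the game
(`gameSecure_toCPA`).

*Correctness of extraction* is not derived from the same property of the weak PRF, since the honest
program for the weak PRF need not be of the form `reduce C`. Instead, the program that decrypts its
challenge with a marked key wins the CPA game with probability close to one (`prob_agree_le`), and
an adversary that makes one marking query and outputs this program cannot remove the mark
(`extractionCorrect_toCPA`). The worst mark is supplied as advice.

*Simulation.* The view of `C` cannot be computed from the view of `reduce C`. So the simulator of the
weak PRF is applied to another program with black-box access to `C`: `replay C` ignores its
challenge, runs the whole CPA game with `C` on samples from its oracle, and outputs the view of `C`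
(`view_replay`). This is exact, so perfect, statistical and computational simulation are preserved
(`keySimulation_toCPA`).

*Meaningfulness.* A decryption needs one evaluation of the weak PRF, so `reduce` applied to a program
with a built-in decryption key is a program with a built-in key of the weak PRF
(`erase_keyed_reduceKeyed`).

*Programs.* Time is not observable by programs, so their behaviour is studied without time charges
(`Code.sem`). A reduction is realised by running `C` with a handler for its messages
(`Code.Realises`), and the result is polynomial if the answers are short and the state of the
handler grows slowly (`Code.GoodHandler.withinTime`). The same code serves for black-box access to
`C` (`Code.blackBox`) and for programs given as data (`Code.wrapData`).
-/

noncomputable section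

namespace WM

open Val

/-! ### Interactive computations -/

namespace Comp

variable {α β γ σ σ' : Type}

theorem bind_assoc (m : Comp α) (f : α → Comp β) (g : β → Comp γ) :
    (m.bind f).bind g = m.bind fun a => (f a).bind g := by
  induction m <;> simp_all [-Bool.forall_bool, bind]

@[simp] theorem erase_bind (m : Comp α) (f : α → Comp β) :
    (m.bind f).erase = m.erase.bind fun a => (f a).erase := by
  induction m <;> simp_all [-Bool.forall_bool, bind, erase]

@[simp] theorem erase_erase (m : Comp α) : m.erase.erase = m.erase := by
  induction m <;> simp_all [-Bool.forall_bool, erase]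

theorem simulate_bind (h : σ → Val → Comp (Val × σ)) (m : Comp α) (f : α → Comp β) (s : σ) :
    (m.bind f).simulate h s = (m.simulate h s).bind fun r => (f r.1).simulate h r.2 := by
  induction m generalizing s <;> simp_all [-Bool.forall_bool, bind, simulate, bind_assoc]

theorem erase_simulate (h : σ → Val → Comp (Val × σ)) (m : Comp α) (s : σ) :
    (m.simulate h s).erase = m.erase.simulate (fun s q => (h s q).erase) s := by
  induction m generalizing s <;> simp_all [-Bool.forall_bool, erase, simulate]

/-- Two handlers that agree up to an encoding `e` of the states simulate alike. -/
theorem simulate_of_encoding (e : σ → σ') {h : σ → Val → Comp (Val × σ)}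
    {h' : σ' → Val → Comp (Val × σ')}
    (he : ∀ s q, h' (e s) q = (h s q).bind fun r => ret (r.1, e r.2)) (m : Comp α) (s : σ) :
    m.simulate h' (e s) = (m.simulate h s).bind fun r => ret (r.1, e r.2) := by
  induction m generalizing s <;> simp_all [-Bool.forall_bool, simulate, bind, bind_assoc]

/-- Nested simulations are one simulation with the pair of the states. -/
theorem simulate_simulate (h₂ : σ' → Val → Comp (Val × σ')) (h₁ : σ → Val → Comp (Val × σ))
    (m : Comp α) (s₁ : σ) (s₂ : σ') :
    (m.simulate h₁ s₁).simulate h₂ s₂ =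
      (m.simulate (fun (s : σ × σ') q => ((h₁ s.1 q).simulate h₂ s.2).bind fun r =>
        ret (r.1.1, (r.1.2, r.2))) (s₁, s₂)).bind fun r => ret ((r.1, r.2.1), r.2.2) := by
  induction m generalizing s₁ s₂ <;> simp_all [-Bool.forall_bool, simulate, bind, bind_assoc, simulate_bind]

theorem runOracle_bind (O : σ → Val → PMF (Val × σ)) (m : Comp α) (f : α → Comp β) (s : σ) :
    (m.bind f).runOracle O s = (m.runOracle O s).bind fun r => (f r.1).runOracle O r.2 := by
  induction m generalizing s <;> simp_all [-Bool.forall_bool, bind, runOracle, PMF.bind_bind, PMF.pure_bind]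

theorem runOracle_erase (O : σ → Val → PMF (Val × σ)) (m : Comp α) (s : σ) :
    m.erase.runOracle O s = m.runOracle O s := by
  induction m generalizing s <;> simp_all [-Bool.forall_bool, erase, runOracle]

theorem dist_bind (m : Comp α) (f : α → Comp β) :
    (m.bind f).dist = m.dist.bind fun a => (f a).dist := by
  induction m <;> simp_all [-Bool.forall_bool, bind, dist, PMF.bind_bind, PMF.pure_bind]

theorem dist_erase (m : Comp α) : m.erase.dist = m.dist := by
  induction m <;> simp_all [-Bool.forall_bool, erase, dist]

/-- An oracle in front of a handler is an oracle with the pair of the states. -/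
def handlerOracle (O : σ' → Val → PMF (Val × σ')) (h : σ → Val → Comp (Val × σ)) (s : σ × σ')
    (q : Val) : PMF (Val × (σ × σ')) :=
  ((h s.1 q).runOracle O s.2).map fun r => (r.1.1, (r.1.2, r.2))

theorem runOracle_simulate (O : σ' → Val → PMF (Val × σ')) (h : σ → Val → Comp (Val × σ))
    (m : Comp α) (s : σ) (s' : σ') :
    (m.simulate h s).runOracle O s' =
      (m.runOracle (handlerOracle O h) (s, s')).map fun r => ((r.1, r.2.1), r.2.2) := by
  induction m generalizing s s' <;>
    simp_all [-Bool.forall_bool, simulate, runOracle, runOracle_bind, handlerOracle, PMF.map_bind, PMF.bind_map,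
      PMF.pure_map, Function.comp_def]

/-- If an oracle becomes another one when its states are projected, so do the results. -/
theorem runOracle_projection (π : σ' → σ) {O' : σ' → Val → PMF (Val × σ')}
    {O : σ → Val → PMF (Val × σ)} (hO : ∀ s q, (O' s q).map (Prod.map id π) = O (π s) q)
    (m : Comp α) (s : σ') :
    (m.runOracle O' s).map (Prod.map id π) = m.runOracle O (π s) := by
  induction m generalizing s with
  | ret a => simp [runOracle, PMF.pure_map]
  | flip k ih => simp [runOracle, PMF.map_bind, ih]
  | call q k ih =>
    simp only [runOracle, PMF.map_bind, ih, ← hO, PMF.bind_map]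
    rfl
  | tick c m ih => simp [runOracle, ih]

theorem runOracle_projection_fst (π : σ' → σ) {O' : σ' → Val → PMF (Val × σ')}
    {O : σ → Val → PMF (Val × σ)} (hO : ∀ s q, (O' s q).map (Prod.map id π) = O (π s) q)
    (m : Comp α) (s : σ') :
    (m.runOracle O' s).map Prod.fst = (m.runOracle O (π s)).map Prod.fst := by
  rw [← runOracle_projection π hO, PMF.map_comp]
  rfl

/-! ### Running times -/

/-- `m.Bdd s P t`: for all coins and all answers of size at most `s`, the computation takes time at
most `t` (writing the result not included), and its result satisfies `P`. -/
def Bdd (s : ℕ) (P : α → Prop) : Comp α → ℕ → Prop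
  | ret a, _ => P a
  | flip k, t => 1 ≤ t ∧ ∀ b, (k b).Bdd s P (t - 1)
  | call q k, t => q.size ≤ t ∧ ∀ a : Val, a.size ≤ s → (k a).Bdd s P (t - q.size)
  | tick c m, t => c ≤ t ∧ m.Bdd s P (t - c)

/-- For all coins and all answers of size at most `s`, the result satisfies `P`. -/
def Post (s : ℕ) (P : α → Prop) : Comp α → Prop
  | ret a => P a
  | flip k => ∀ b, (k b).Post s P
  | call _ k => ∀ a : Val, a.size ≤ s → (k a).Post s P
  | tick _ m => m.Post s P

theorem WithinTime.mono {s s' t t' : ℕ} (hs : s' ≤ s) (ht : t ≤ t') {m : Comp Val}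
    (h : m.WithinTime s t) : m.WithinTime s' t' := by
  induction m generalizing t t' with
  | ret a => exact le_trans h ht
  | flip k ih => exact ⟨h.1.trans ht, fun b => ih b (by omega) (h.2 b)⟩
  | call q k ih =>
    exact ⟨h.1.trans ht, fun a ha => ih a (by omega) (h.2 a (ha.trans hs))⟩
  | tick c m ih => exact ⟨h.1.trans ht, ih (by omega) h.2⟩

theorem Bdd.mono {s t t' : ℕ} {P Q : α → Prop} (hP : ∀ a, P a → Q a) (ht : t ≤ t') {m : Comp α}
    (h : m.Bdd s P t) : m.Bdd s Q t' := by
  induction m generalizing t t' with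
  | ret a => exact hP _ h
  | flip k ih => exact ⟨h.1.trans ht, fun b => ih b (by omega) (h.2 b)⟩
  | call q k ih => exact ⟨h.1.trans ht, fun a ha => ih a (by omega) (h.2 a ha)⟩
  | tick c m ih => exact ⟨h.1.trans ht, ih (by omega) h.2⟩

theorem Bdd.bind {s t t' : ℕ} {P : α → Prop} {Q : β → Prop} {m : Comp α} {f : α → Comp β}
    (hm : m.Bdd s P t) (hf : ∀ a, P a → (f a).Bdd s Q t') : (m.bind f).Bdd s Q (t + t') := by
  induction m generalizing t with
  | ret a => exact (hf a hm).mono (fun _ h => h) (by omega)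
  | flip k ih =>
    have := hm.1
    exact ⟨by omega, fun b => (ih b (hm.2 b)).mono (fun _ h => h) (by omega)⟩
  | call q k ih =>
    refine ⟨hm.1.trans (by omega), fun a ha => (ih a (hm.2 a ha)).mono (fun _ h => h) ?_⟩
    have := hm.1
    omega
  | tick c m ih =>
    refine ⟨hm.1.trans (by omega), (ih hm.2).mono (fun _ h => h) ?_⟩
    have := hm.1
    omega

theorem WithinTime.bdd {s t : ℕ} {m : Comp Val} (h : m.WithinTime s t) :
    m.Bdd s (fun v => v.size ≤ t) t := by
  induction m generalizing t with
  | ret a => exact h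
  | flip k ih => exact ⟨h.1, fun b => (ih b (h.2 b)).mono (fun _ h => by omega) le_rfl⟩
  | call q k ih => exact ⟨h.1, fun a ha => (ih a (h.2 a ha)).mono (fun _ h => by omega) le_rfl⟩
  | tick c m ih => exact ⟨h.1, (ih h.2).mono (fun _ h => by omega) le_rfl⟩

theorem Bdd.withinTime {s t r : ℕ} {m : Comp Val} (h : m.Bdd s (fun v => v.size ≤ r) t) :
    m.WithinTime s (t + r) := by
  induction m generalizing t with
  | ret a => exact le_trans h (by omega)
  | flip k ih =>
    have := h.1
    exact ⟨by omega, fun b => (ih b (h.2 b)).mono le_rfl (by omega)⟩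
  | call q k ih =>
    refine ⟨h.1.trans (by omega), fun a ha => (ih a (h.2 a ha)).mono le_rfl ?_⟩
    have := h.1
    omega
  | tick c m ih =>
    refine ⟨h.1.trans (by omega), (ih h.2).mono le_rfl ?_⟩
    have := h.1
    omega

theorem Bdd.and_post {s t : ℕ} {P Q : α → Prop} {m : Comp α} (h : m.Bdd s P t)
    (h' : m.Post s Q) : m.Bdd s (fun a => P a ∧ Q a) t := by
  induction m generalizing t with
  | ret a => exact ⟨h, h'⟩
  | flip k ih => exact ⟨h.1, fun b => ih b (h.2 b) (h' b)⟩
  | call q k ih => exact ⟨h.1, fun a ha => ih a (h.2 a ha) (h' a ha)⟩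
  | tick c m ih => exact ⟨h.1, ih h.2 h'⟩

theorem post_erase {s : ℕ} {P : α → Prop} {m : Comp α} : m.erase.Post s P ↔ m.Post s P := by
  induction m <;> simp_all [-Bool.forall_bool, erase, Post]

theorem Bdd.of_mem_support {s t : ℕ} {P : α → Prop} (hs : 1 ≤ s) {m : Comp α} (h : m.Bdd s P t)
    {a : α} (ha : a ∈ m.dist.support) : P a := by
  induction m generalizing t with
  | ret b =>
    simp only [dist, PMF.support_pure, Set.mem_singleton_iff] at ha
    exact ha ▸ h
  | flip k ih =>
    simp only [dist, PMF.mem_support_bind_iff] at ha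
    obtain ⟨b, -, hb⟩ := ha
    exact ih b (h.2 b) hb
  | call q k ih => exact ih leaf (h.2 leaf hs) ha
  | tick c m ih => exact ih h.2 ha

theorem _root_.WM.Val.one_le_size (v : Val) : 1 ≤ v.size := by
  cases v <;> simp [Val.size]

/-- A simulation takes time at most `B` for each unit of time of the simulated program, if the
handler takes time at most `B` on each query as long as an invariant `I` of its state holds, which
may depend on the time that is left. -/
theorem WithinTime.simulate {h : σ → Val → Comp (Val × σ)} {I : σ → ℕ → Prop} {s s' B : ℕ}
    (hI : ∀ st t t', t' ≤ t → I st t → I st t')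
    (hh : ∀ st q t, q.size ≤ t → I st t →
      (h st q).Bdd s (fun r => r.1.size ≤ s' ∧ I r.2 (t - q.size)) B)
    {m : Comp Val} {t : ℕ} (hm : m.WithinTime s' t) {st : σ} (hst : I st t) :
    (m.simulate h st).Bdd s (fun r => r.1.size ≤ t ∧ I r.2 0) (t * (B + 1)) := by
  induction m generalizing t st with
  | ret a => exact ⟨hm, hI _ _ _ (by omega) hst⟩
  | flip k ih =>
    obtain ⟨h1, h2⟩ := hm
    obtain ⟨t, rfl⟩ : ∃ t₀, t = t₀ + 1 := ⟨t - 1, by omega⟩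
    refine ⟨by nlinarith, fun b => (ih b (h2 b) (hI _ _ _ (by omega) hst)).mono
      (fun _ h => ⟨h.1.trans (by omega), h.2⟩) ?_⟩
    rw [Nat.add_sub_cancel, add_mul]
    omega
  | call q k ih =>
    obtain ⟨h1, h2⟩ := hm
    refine ((hh st q t h1 hst).bind fun r hr => (ih r.1 (h2 _ hr.1) hr.2)).mono
      (fun _ h => ⟨h.1.trans (by omega), h.2⟩) ?_
    obtain ⟨t, rfl⟩ : ∃ t₀, t = t₀ + q.size := ⟨t - q.size, by omega⟩
    have := q.one_le_size
    rw [Nat.add_sub_cancel]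
    nlinarith
  | tick c m ih =>
    obtain ⟨h1, h2⟩ := hm
    obtain ⟨t, rfl⟩ : ∃ t₀, t = t₀ + c := ⟨t - c, by omega⟩
    refine ⟨by nlinarith, (ih h2 (hI _ _ _ (by omega) hst)).mono
      (fun _ h => ⟨h.1.trans (by omega), h.2⟩) ?_⟩
    rw [Nat.add_sub_cancel, add_mul]
    have : c ≤ c * (B + 1) := Nat.le_mul_of_pos_right _ (by omega)
    omega

/-- The computation after its first time charge. -/
def untick : Comp α → Comp α
  | tick _ m => m
  | m => m

end Comp

/-! ### Programs: semantics without time, and polynomial running times -/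

theorem Val.left_size_le (v : Val) : v.left.size ≤ v.size := by
  cases v <;> simp [Val.left, Val.size]; omega

theorem Val.right_size_le (v : Val) : v.right.size ≤ v.size := by
  cases v <;> simp [Val.right, Val.size]; omega

theorem Val.len_le_size (v : Val) : v.len ≤ v.size := by
  induction v with
  | leaf => simp [Val.len]
  | node a b _ ih => simp only [Val.len, Val.size]; omega

theorem Val.size_left_add_right_le (v : Val) : v.left.size + v.right.size ≤ v.size + 1 := by
  cases v <;> simp [Val.left, Val.right, Val.size]; omega

theorem eval_mono (p : Polynomial ℕ) {a b : ℕ} (h : a ≤ b) : p.eval a ≤ p.eval b := by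
  induction p using Polynomial.induction_on' with
  | add p q hp hq => simpa using add_le_add hp hq
  | monomial n c => simpa using Nat.mul_le_mul_left _ (Nat.pow_le_pow_left h n)

namespace Code

/-- The computation of a program, without its time charges. -/
def sem (ρ : Behaviour) (c : Code) (v : Val) : Comp Val := (c.eval ρ v).erase

section sem

variable (ρ : Behaviour) (c d : Code) (v : Val)

@[simp] theorem sem_nil : nil.sem ρ v = .ret leaf := rfl
@[simp] theorem sem_id : id.sem ρ v = .ret v := rfl
@[simp] theorem sem_fst : fst.sem ρ v = .ret v.left := rfl
@[simp] theorem sem_snd : snd.sem ρ v = .ret v.right := rfl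
@[simp] theorem sem_flip : flip.sem ρ v = .flip fun b => .ret (bit b) := rfl
@[simp] theorem sem_call : call.sem ρ v = .call v .ret := rfl
@[simp] theorem sem_subj : subj.sem ρ v = (ρ v).erase := rfl

@[simp] theorem sem_pair : (pair c d).sem ρ v =
    (c.sem ρ v).bind fun a => (d.sem ρ v).bind fun b => .ret (node a b) := by
  simp [sem, eval, Comp.erase]

@[simp] theorem sem_comp : (comp c d).sem ρ v = (d.sem ρ v).bind (c.sem ρ) := by
  simp only [sem, eval, Comp.erase, Comp.erase_bind]
  rfl

theorem sem_cond : (cond c d).sem ρ v =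
    match v.left with
    | leaf => c.sem ρ v
    | node _ _ => d.sem ρ v := by
  simp only [sem, eval, Comp.erase]
  cases v.left <;> rfl

theorem sem_loop : (loop c).sem ρ v =
    (fun m : Comp Val => m.bind (c.sem ρ))^[v.left.len] (.ret v.right) := by
  simp only [sem, eval, Comp.erase]
  induction v.left.len with
  | zero => rfl
  | succ n ih =>
    rw [Function.iterate_succ_apply', Function.iterate_succ_apply', Comp.erase_bind, ih]
    rfl

theorem sem_loop_of_pure (f : Val → Val) (hf : ∀ v, c.sem ρ v = .ret (f v)) :
    (loop c).sem ρ v = .ret (f^[v.left.len] v.right) := by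
  rw [sem_loop]
  induction v.left.len with
  | zero => rfl
  | succ n ih => simp [Function.iterate_succ_apply', ih, Comp.bind, hf]

theorem sem_sim : (sim c d).sem ρ v =
    ((c.sem ρ v.right).simulate
      (fun s m => (d.sem ρ (node s m)).bind fun r => .ret (r.right, r.left)) v.left).bind
      fun r => .ret (node r.2 r.1) := by
  simp [sem, eval, Comp.erase, Comp.erase_simulate]

end sem

/-- Time is not observable: the computation of a program depends only on the computations, without
time charges, of the program to which it has black-box access. -/
theorem sem_congr {ρ ρ' : Behaviour} (h : ∀ v, (ρ v).erase = (ρ' v).erase) (c : Code) :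
    c.sem ρ = c.sem ρ' := by
  induction c with
  | pair c d hc hd => funext v; simp [hc, hd]
  | comp c d hc hd => funext v; simp [hc, hd]
  | cond c d hc hd => funext v; simp [sem_cond, hc, hd]
  | loop c hc => funext v; simp [sem_loop, hc]
  | sim c d hc hd => funext v; simp [sem_sim, hc, hd]
  | subj => funext v; simp [h]
  | _ => rfl

theorem dist_sem (ρ : Behaviour) (c : Code) (v : Val) : (c.sem ρ v).dist = (c.eval ρ v).dist :=
  Comp.dist_erase _

theorem eval_eq_tick (ρ : Behaviour) (c : Code) (v : Val) :
    c.eval ρ v = .tick (v.size + 1) (c.eval ρ v).untick := by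
  cases c <;> rfl

theorem size_lt_of_withinTime {ρ : Behaviour} {c : Code} {v : Val} {s t : ℕ}
    (h : (c.eval ρ v).WithinTime s t) : v.size < t := by
  rw [eval_eq_tick] at h
  exact h.1

/-- The program `R` in place of the black-box access. -/
def subst (c R : Code) : Code :=
  match c with
  | pair c d => pair (c.subst R) (d.subst R)
  | comp c d => comp (c.subst R) (d.subst R)
  | cond c d => cond (c.subst R) (d.subst R)
  | loop c => loop (c.subst R)
  | sim c d => sim (c.subst R) (d.subst R)
  | subj => R
  | c => c

/-- Substitution of `R` is black-box access to `R`, up to the time charge for a use of the black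
box, which the evaluation of `R` contains already. -/
theorem eval_subst (ρ : Behaviour) (R c : Code) :
    (c.subst R).eval ρ = c.eval fun v => (R.eval ρ v).untick := by
  induction c with
  | subj => funext v; exact eval_eq_tick ρ R v
  | _ => simp_all [subst, eval]

theorem sem_subst (ρ : Behaviour) (R c : Code) : (c.subst R).sem ρ = c.sem (R.sem ρ) := by
  funext v
  rw [sem, eval_subst]
  refine congrFun (sem_congr (fun w => ?_) c) v
  rw [sem, eval_eq_tick]
  simp [Comp.erase, Comp.untick]

/-- The encoding of the program `c`, with the data `hole` for the black-box access. -/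
def encodeWith (hole : Val) : Code → Val
  | pair c d => node (unary 4) (node (c.encodeWith hole) (d.encodeWith hole))
  | comp c d => node (unary 5) (node (c.encodeWith hole) (d.encodeWith hole))
  | cond c d => node (unary 6) (node (c.encodeWith hole) (d.encodeWith hole))
  | loop c => node (unary 7) (node (c.encodeWith hole) leaf)
  | sim c h => node (unary 10) (node (c.encodeWith hole) (h.encodeWith hole))
  | subj => hole
  | c => c.encode

theorem decode_encodeWith (hole : Val) (c : Code) :
    decode (c.encodeWith hole) = c.subst (decode hole) := by
  induction c <;>
    simp_all [encode, encodeWith, subst, decode, unary, ofList, len, List.replicate]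

/-- The program that returns `v` on every input. -/
def const : Val → Code
  | leaf => nil
  | node a b => pair (const a) (const b)

@[simp] theorem sem_const (ρ : Behaviour) (w v : Val) : (const w).sem ρ v = .ret w := by
  induction w <;> simp_all [const, Comp.bind]

/-- The program that computes `c.encodeWith hole` from `hole`. -/
def quote : Code → Code
  | pair c d => pair (const (unary 4)) (pair c.quote d.quote)
  | comp c d => pair (const (unary 5)) (pair c.quote d.quote)
  | cond c d => pair (const (unary 6)) (pair c.quote d.quote)
  | loop c => pair (const (unary 7)) (pair c.quote nil)
  | sim c d => pair (const (unary 10)) (pair c.quote d.quote)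
  | subj => id
  | c => const c.encode

@[simp] theorem sem_quote (ρ : Behaviour) (c : Code) (v : Val) :
    c.quote.sem ρ v = .ret (c.encodeWith v) := by
  induction c <;> simp_all [quote, encodeWith, Comp.bind]

/-! ### Polynomial time -/

/-- The program runs in polynomial time, uniformly for black-box access to the programs in `B`. -/
def PolyFor (B : Set Behaviour) (c : Code) : Prop :=
  ∃ p : Polynomial ℕ, ∀ ρ ∈ B, ∀ (s : ℕ) (v : Val),
    (c.eval ρ v).WithinTime s (p.eval (v.size + s))

theorem polyFor_noSubj {c : Code} : PolyFor {noSubj} c ↔ c.PolyTime := by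
  simp [PolyFor, PolyTime]

namespace PolyFor

variable {B : Set Behaviour} {c d : Code}

theorem mono {B' : Set Behaviour} (h : B' ⊆ B) (hc : PolyFor B c) : PolyFor B' c := by
  obtain ⟨p, hp⟩ := hc
  exact ⟨p, fun ρ hρ => hp ρ (h hρ)⟩

theorem nil : PolyFor B nil :=
  ⟨Polynomial.X + 2, fun ρ _ s v => by simp [eval, Comp.WithinTime, Val.size]; omega⟩

theorem id : PolyFor B id :=
  ⟨2 * Polynomial.X + 1, fun ρ _ s v => by simp [eval, Comp.WithinTime]; omega⟩

theorem fst : PolyFor B fst :=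
  ⟨2 * Polynomial.X + 1, fun ρ _ s v => by
    have := v.left_size_le
    simp [eval, Comp.WithinTime]; omega⟩

theorem snd : PolyFor B snd :=
  ⟨2 * Polynomial.X + 1, fun ρ _ s v => by
    have := v.right_size_le
    simp [eval, Comp.WithinTime]; omega⟩

theorem flip : PolyFor B flip :=
  ⟨Polynomial.X + 5, fun ρ _ s v => by
    simp only [eval, Comp.WithinTime, Polynomial.eval_add, Polynomial.eval_X,
      Polynomial.eval_ofNat]
    exact ⟨by omega, by omega, fun b => by cases b <;> simp [bit, Val.size] <;> omega⟩⟩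

theorem call : PolyFor B call :=
  ⟨4 * Polynomial.X + 1, fun ρ _ s v => by
    simp only [eval, Comp.WithinTime, Polynomial.eval_add, Polynomial.eval_X,
      Polynomial.eval_ofNat, Polynomial.eval_mul, Polynomial.eval_one]
    exact ⟨by omega, by omega, fun a ha => by omega⟩⟩

theorem pair (hc : PolyFor B c) (hd : PolyFor B d) : PolyFor B (pair c d) := by
  obtain ⟨p, hp⟩ := hc
  obtain ⟨r, hr⟩ := hd
  refine ⟨Polynomial.X + 2 + 2 * p + 2 * r, fun ρ hρ s v => ?_⟩
  have h := (hp ρ hρ s v).bdd.bind fun a ha =>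
    ((hr ρ hρ s v).bdd.bind (f := fun b => .ret (node a b)) (t' := 0)
      (Q := fun w => w.size ≤ p.eval (v.size + s) + r.eval (v.size + s) + 1)
      fun b hb => by simp only [Comp.Bdd, Val.size]; omega)
  simp only [eval, Comp.WithinTime, Polynomial.eval_add, Polynomial.eval_X, Polynomial.eval_mul,
    Polynomial.eval_ofNat]
  exact ⟨by omega, h.withinTime.mono le_rfl (by omega)⟩

theorem comp (hc : PolyFor B c) (hd : PolyFor B d) : PolyFor B (comp c d) := by
  obtain ⟨p, hp⟩ := hc
  obtain ⟨r, hr⟩ := hd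
  refine ⟨Polynomial.X + 1 + r + 2 * p.comp (r + Polynomial.X), fun ρ hρ s v => ?_⟩
  have h := (hr ρ hρ s v).bdd.bind (f := c.eval ρ) fun a ha =>
    (((hp ρ hρ s a).mono le_rfl (eval_mono p (show _ ≤ r.eval (v.size + s) + (v.size + s) by
      omega))).bdd)
  simp only [eval, Comp.WithinTime, Polynomial.eval_add, Polynomial.eval_X, Polynomial.eval_mul,
    Polynomial.eval_ofNat, Polynomial.eval_comp, Polynomial.eval_one]
  exact ⟨by omega, h.withinTime.mono le_rfl (by omega)⟩

theorem cond (hc : PolyFor B c) (hd : PolyFor B d) : PolyFor B (cond c d) := by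
  obtain ⟨p, hp⟩ := hc
  obtain ⟨r, hr⟩ := hd
  refine ⟨Polynomial.X + 1 + p + r, fun ρ hρ s v => ?_⟩
  simp only [eval, Comp.WithinTime, Polynomial.eval_add, Polynomial.eval_X, Polynomial.eval_one]
  refine ⟨by omega, ?_⟩
  split
  · exact (hp ρ hρ s v).mono le_rfl (by omega)
  · exact (hr ρ hρ s v).mono le_rfl (by omega)

theorem const (w : Val) : PolyFor B (const w) := by
  induction w with
  | leaf => exact nil
  | node a b ha hb => exact pair ha hb

theorem quote (c : Code) : PolyFor B c.quote := by
  induction c with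
  | pair c d hc hd => exact pair (const _) (pair hc hd)
  | comp c d hc hd => exact pair (const _) (pair hc hd)
  | cond c d hc hd => exact pair (const _) (pair hc hd)
  | loop c hc => exact pair (const _) (pair hc nil)
  | sim c d hc hd => exact pair (const _) (pair hc hd)
  | subj => exact id
  | _ => exact const _

/-- A loop runs in polynomial time if its body adds at most a constant to the size of the data. -/
theorem loop (hc : PolyFor B c) (K : ℕ)
    (hK : ∀ ρ ∈ B, ∀ (s : ℕ) (v : Val), (c.sem ρ v).Post s fun w => w.size ≤ v.size + K) :
    PolyFor B (loop c) := by
  obtain ⟨p, hp⟩ := hc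
  refine ⟨Polynomial.X + 1 + Polynomial.X * p.comp (Polynomial.X + Polynomial.X * (K : Polynomial ℕ))
    + (Polynomial.X + Polynomial.X * (K : Polynomial ℕ)), fun ρ hρ s v => ?_⟩
  simp only [eval, Comp.WithinTime, Polynomial.eval_add, Polynomial.eval_X, Polynomial.eval_one,
    Polynomial.eval_comp, Polynomial.eval_mul, Polynomial.eval_natCast, Nat.cast_id]
  refine ⟨by omega, ?_⟩
  have hv := v.right_size_le
  have key : ∀ j, j ≤ v.size →
      ((fun m : Comp Val => m.bind (c.eval ρ))^[j] (.ret v.right)).Bdd s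
        (fun w => w.size ≤ v.size + j * K)
        (j * p.eval ((v.size + s) + (v.size + s) * K)) := by
    intro j
    induction j with
    | zero => intro _; simpa [Comp.Bdd] using hv
    | succ j ih =>
      intro hj
      rw [Function.iterate_succ_apply']
      refine ((ih (by omega)).bind fun w hw => ?_).mono (fun _ h => h) (add_mul _ _ _).ge
      have hjK : j * K ≤ (v.size + s) * K := Nat.mul_le_mul_right _ (by omega)
      refine ((hp ρ hρ s w).bdd.and_post (Comp.post_erase.1 (hK ρ hρ s w))).mono
        (fun x hx => ?_) ?_
      · rw [add_mul]; omega
      · rw [one_mul]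
        exact eval_mono p (by omega)
  have h := key v.left.len ((v.left.len_le_size).trans v.left_size_le)
  have hl : v.left.len ≤ v.size := (v.left.len_le_size).trans v.left_size_le
  have h1 : v.left.len * K ≤ (v.size + s) * K := Nat.mul_le_mul_right _ (by omega)
  have h2 := Nat.mul_le_mul_right (p.eval ((v.size + s) + (v.size + s) * K))
    (show v.left.len ≤ v.size + s by omega)
  exact (h.mono (fun _ hw => hw.trans (show _ ≤ (v.size + s) + (v.size + s) * K by omega))
    le_rfl).withinTime.mono le_rfl (by omega)

end PolyFor

/-- A handler of messages whose state is a pair of a constant and a variable component, such that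
its answers are short, and the state grows slowly: by a bounded amount and at most the size of the
query, which was paid for by the program that sent it. The constant `10` is generous enough for all
handlers below. -/
structure GoodHandler (h : Code) : Prop where
  polyFor : PolyFor Set.univ h
  post : ∀ (ρ : Behaviour) (s : ℕ) (st q : Val), (h.sem ρ (node st q)).Post s fun r =>
    r.left.left = st.left ∧ r.right.size ≤ 10 * (s + st.left.size) ∧
      r.left.size ≤ st.size + 10 * (s + st.left.size) + q.size

/-- A simulation with a good handler takes time polynomial in the time that the simulated program
takes when it receives messages that may be longer by a constant factor. -/
theorem GoodHandler.withinTime {h : Code} (hh : GoodHandler h) :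
    ∃ P : Polynomial ℕ, ∀ (ρ : Behaviour) (c : Code) (v : Val) (s t : ℕ),
      (c.eval ρ v.right).WithinTime (10 * (s + v.left.left.size)) t →
      ((sim c h).eval ρ v).WithinTime s (P.eval (t + v.size + s)) := by
  obtain ⟨⟨p, hp⟩, hpost⟩ := hh
  let G : Polynomial ℕ := Polynomial.X + Polynomial.X * (10 * Polynomial.X + 1)
  let H : Polynomial ℕ := p.comp (G + 2 * Polynomial.X + 1)
  refine ⟨Polynomial.X + 1 + Polynomial.X * (2 * H + 1) + Polynomial.X + G + 1, fun ρ c v s t hc => ?_⟩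
  obtain ⟨N, hN⟩ : ∃ N, N = t + v.size + s := ⟨_, rfl⟩
  obtain ⟨g, hg⟩ : ∃ g, g = 10 * (s + v.left.left.size) + 1 := ⟨_, rfl⟩
  have hG : v.left.size + t * g ≤ G.eval N := by
    simp only [G, Polynomial.eval_add, Polynomial.eval_X, Polynomial.eval_one,
      Polynomial.eval_mul, Polynomial.eval_ofNat]
    have := v.left_size_le
    have := v.left.left_size_le
    have : t * g ≤ N * (10 * N + 1) := Nat.mul_le_mul (by omega) (by omega)
    omega
  have hH : H.eval N = p.eval (G.eval N + 2 * N + 1) := by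
    simp [H, Polynomial.eval_comp]
  -- while a budget `u` is left, the state can grow by at most `g` for each unit of it
  have key := hc.simulate (s := s) (B := 2 * H.eval N) (st := v.left)
    (h := fun st m => (h.eval ρ (node st m)).bind fun r => .ret (r.right, r.left))
    (I := fun st u => st.left = v.left.left ∧ st.size + u * g ≤ G.eval N ∧ u ≤ t)
    (fun st u u' hu hI => ⟨hI.1, by nlinarith [hI.2.1], hu.trans hI.2.2⟩)
    (fun st q u hq hI => by
      have hb := ((hp ρ (Set.mem_univ _) s (node st q)).bdd).and_post
        (Comp.post_erase.1 (hpost ρ s st q))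
      refine (hb.bind (t' := 0) fun r hr => ?_).mono (fun _ h => h) (?_ : _ ≤ 2 * H.eval N)
      · obtain ⟨-, h1, h2, h3⟩ := hr
        rw [hI.1] at h1 h2 h3
        refine ⟨h2, h1, ?_, by omega⟩
        have := hI.2.1
        have := q.one_le_size
        obtain ⟨u, rfl⟩ : ∃ u₀, u = u₀ + q.size := ⟨u - q.size, by omega⟩
        rw [Nat.add_sub_cancel]
        have : g ≤ q.size * g := Nat.le_mul_of_pos_left _ (by omega)
        have e : (u + q.size) * g = u * g + q.size * g := add_mul _ _ _
        have : q.size * g = q.size * (g - 1) + q.size := by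
          rw [hg, Nat.add_sub_cancel, mul_add, mul_one]
        have : g - 1 ≤ q.size * (g - 1) := Nat.le_mul_of_pos_left _ (by omega)
        dsimp only
        omega
      · have := eval_mono p (show (node st q).size + s ≤ G.eval N + 2 * N + 1 by
          have := hI.2.1
          have := hI.2.2
          simp only [Val.size]
          have : 0 ≤ u * g := Nat.zero_le _
          omega)
        omega)
    ⟨rfl, hG, le_rfl⟩
  simp only [eval, Comp.WithinTime, Polynomial.eval_add, Polynomial.eval_X, Polynomial.eval_one,
    Polynomial.eval_mul, Polynomial.eval_ofNat, ← hN]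
  refine ⟨by omega, ?_⟩
  refine ((key.bind (t' := 0) (f := fun r => .ret (node r.2 r.1))
    (Q := fun w => w.size ≤ t + G.eval N + 1) fun r hr => ?_).withinTime).mono le_rfl ?_
  · have := hr.2.2.1
    have := hr.1
    simp only [Comp.Bdd, Val.size]
    omega
  · have : t * (2 * H.eval N + 1) ≤ N * (2 * H.eval N + 1) := Nat.mul_le_mul_right _ (by omega)
    omega

theorem PolyFor.sim {B : Set Behaviour} {c h : Code} (hc : PolyFor B c) (hh : GoodHandler h) :
    PolyFor B (sim c h) := by
  obtain ⟨p, hp⟩ := hc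
  obtain ⟨P, hP⟩ := hh.withinTime
  refine ⟨P.comp (p.comp (21 * Polynomial.X) + Polynomial.X), fun ρ hρ s v =>
    (hP ρ c v s _ (hp ρ hρ _ _)).mono le_rfl ?_⟩
  simp only [Polynomial.eval_comp, Polynomial.eval_add, Polynomial.eval_mul, Polynomial.eval_X,
    Polynomial.eval_ofNat]
  have h1 := v.left_size_le
  have h2 := v.left.left_size_le
  have h3 := v.right_size_le
  have := eval_mono p (show v.right.size + 10 * (s + v.left.left.size) ≤ 21 * (v.size + s) by omega)
  exact eval_mono P (by omega)

end Code

/-! ### Programs for operations on bit strings -/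

namespace Comp

variable {α β : Type}

@[simp] theorem ret_bind (a : α) (f : α → Comp β) : (ret a).bind f = f a := rfl

@[simp] theorem flip_bind (k : Bool → Comp α) (f : α → Comp β) :
    (flip k).bind f = flip fun b => (k b).bind f := rfl

@[simp] theorem call_bind (q : Val) (k : Val → Comp α) (f : α → Comp β) :
    (call q k).bind f = call q fun a => (k a).bind f := rfl

end Comp

namespace Val

@[simp] theorem left_node (a b : Val) : (node a b).left = a := rfl
@[simp] theorem right_node (a b : Val) : (node a b).right = b := rfl
@[simp] theorem left_leaf : leaf.left = leaf := rfl
@[simp] theorem right_leaf : leaf.right = leaf := rfl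
@[simp] theorem toBool_leaf : leaf.toBool = false := rfl
@[simp] theorem toBool_node (a b : Val) : (node a b).toBool = true := rfl
@[simp] theorem toBool_bit (b : Bool) : (bit b).toBool = b := by cases b <;> rfl

theorem size_bit_le (b : Bool) : (bit b).size ≤ 3 := by cases b <;> simp [bit, size]

theorem size_xorVal_le (x m : Val) : (xorVal x m).size ≤ 4 * x.size := by
  induction x generalizing m with
  | leaf => simp [xorVal, size]
  | node a y _ ih =>
    have := ih m.right
    have := size_bit_le (a.toBool ^^ m.left.toBool)
    simp only [xorVal, size]
    omega

/-- The reversal of the list `v`, followed by the list `w`. -/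
def revApp : Val → Val → Val
  | leaf, w => w
  | node a v, w => revApp v (node a w)

theorem revApp_revApp (v w : Val) : revApp (revApp v w) leaf = revApp w v := by
  induction v generalizing w with
  | leaf => rfl
  | node a v _ ih => exact ih _

/-- One step of the loop of `Code.reverse`, on a pair of a list and the reversed prefix. -/
def revStep (v : Val) : Val := node v.left.right (node v.left.left v.right)

theorem iterate_revStep (v w : Val) : revStep^[v.len] (node v w) = node leaf (revApp v w) := by
  induction v generalizing w with
  | leaf => rfl
  | node a v _ ih => exact ih _

/-- One step of the loop of `Code.xor`, on the two remaining strings and the reversed result. -/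
def xorStep (v : Val) : Val :=
  node v.left.right (node v.right.left.right
    (node (bit (v.left.left.toBool ^^ v.right.left.left.toBool)) v.right.right))

theorem iterate_xorStep (x m w : Val) :
    (xorStep^[x.len] (node x (node m w))).right.right = revApp (xorVal x m) w := by
  induction x generalizing m w with
  | leaf => rfl
  | node a x _ ih => exact ih _ _

end Val

namespace Code

/-- Runs `c` if the test `t` returns `leaf`, and `d` otherwise. -/
def branch (t c d : Code) : Code := comp (cond (comp c snd) (comp d snd)) (pair t id)

@[simp] theorem sem_branch (ρ : Behaviour) (t c d : Code) (v : Val) :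
    (branch t c d).sem ρ v =
      (t.sem ρ v).bind fun w => if w.toBool then d.sem ρ v else c.sem ρ v := by
  simp only [branch, sem_comp, sem_pair, sem_id, Comp.ret_bind, Comp.bind_assoc]
  congr 1
  funext w
  cases w <;> simp [sem_cond]

/-- Exclusive or of two bits. -/
def bitXor (c d : Code) : Code :=
  branch c (branch d nil (const (bit true))) (branch d (const (bit true)) nil)

theorem sem_bitXor {ρ : Behaviour} {c d : Code} {v a b : Val} (hc : c.sem ρ v = .ret a)
    (hd : d.sem ρ v = .ret b) : (bitXor c d).sem ρ v = .ret (bit (a.toBool ^^ b.toBool)) := by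
  simp only [bitXor, sem_branch, hc, hd, Comp.ret_bind, sem_nil, sem_const]
  cases a.toBool <;> cases b.toBool <;> rfl

/-- Reversal of a list. -/
def reverse : Code :=
  comp snd (comp (loop (pair (comp snd fst) (pair (comp fst fst) snd))) (pair id (pair id nil)))

theorem sem_reverse (ρ : Behaviour) (v : Val) : reverse.sem ρ v = .ret (revApp v leaf) := by
  simp only [reverse, sem_comp, sem_pair, sem_id, sem_nil, Comp.ret_bind]
  rw [sem_loop_of_pure _ _ _ revStep (fun w => by simp [revStep])]
  simp [iterate_revStep]

/-- Bitwise exclusive or of the two components of the input. -/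
def xor : Code :=
  comp reverse (comp (comp snd snd) (comp
    (loop (pair (comp snd fst) (pair (comp snd (comp fst snd))
      (pair (bitXor (comp fst fst) (comp fst (comp fst snd))) (comp snd snd)))))
    (pair fst (pair fst (pair snd nil)))))

@[simp] theorem sem_xor (ρ : Behaviour) (v : Val) :
    xor.sem ρ v = .ret (xorVal v.left v.right) := by
  simp only [xor, sem_comp, sem_pair, sem_fst, sem_snd, sem_nil, Comp.ret_bind]
  rw [sem_loop_of_pure _ _ _ xorStep (fun w => ?_)]
  · simp [iterate_xorStep, sem_reverse, revApp_revApp, revApp]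
  · simp only [sem_comp, sem_pair, sem_fst, sem_snd, Comp.ret_bind]
    rw [sem_bitXor (a := w.left.left) (b := w.right.left.left) (by simp) (by simp)]
    rfl

/-- Twice a unary number. -/
def double : Code := comp (loop (pair nil id)) (pair id id)

@[simp] theorem sem_double (ρ : Behaviour) (v : Val) :
    double.sem ρ v = .ret ((node leaf)^[v.len] v) := by
  simp only [double, sem_comp, sem_pair, sem_id, Comp.ret_bind]
  rw [sem_loop_of_pure _ _ _ (node leaf) (fun w => by simp)]
  rfl

theorem _root_.WM.Val.iterate_node_leaf_unary (k : ℕ) :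
    (node leaf)^[(unary k).len] (unary k) = unary (2 * k) := by
  have h : ∀ j, (node leaf)^[(unary j).len] (unary k) = unary (j + k) := by
    intro j
    induction j with
    | zero => simp [unary, ofList, len]
    | succ j ih =>
      have e : (unary (j + 1)).len = (unary j).len + 1 := rfl
      rw [e, Function.iterate_succ_apply', ih, Nat.add_right_comm]
      rfl
  rw [h, two_mul]

theorem _root_.WM.Val.size_iterate_node_leaf (j : ℕ) (v : Val) :
    ((node leaf)^[j] v).size = v.size + 2 * j := by
  induction j with
  | zero => rfl
  | succ j ih =>
    rw [Function.iterate_succ_apply']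
    simp only [size, ih]
    omega

/-- As many random bits as the input is long. -/
def randomBits : Code := comp (loop (pair flip id)) (pair id nil)

theorem _root_.WM.uniformBits_succ (l : ℕ) :
    uniformBits (l + 1) = (PMF.uniformOfFintype Bool).bind fun b =>
      (uniformBits l).map fun x => Fin.cons b x := by
  ext y
  rw [uniformBits, PMF.uniformOfFintype_apply, PMF.bind_apply]
  rw [tsum_eq_single (y 0)]
  · rw [PMF.map_apply, tsum_eq_single (Fin.tail y)]
    · simp only [uniformBits, PMF.uniformOfFintype_apply, Fin.cons_self_tail, if_true]
      simp only [Fintype.card_pi, Fintype.card_bool, Finset.prod_const, Finset.card_univ,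
        Fintype.card_fin, pow_succ']
      push_cast
      rw [ENNReal.mul_inv (by simp) (by simp)]
    · intro x hx
      rw [if_neg]
      exact fun h => hx (by rw [h, Fin.tail_cons])
  · intro b hb
    rw [PMF.map_apply, ENNReal.tsum_eq_zero.2, mul_zero]
    intro x
    rw [if_neg]
    rintro rfl
    exact hb (by simp)

theorem dist_randomBits (ρ : Behaviour) (l : ℕ) :
    (randomBits.sem ρ (unary l)).dist = (uniformBits l).map ofBits := by
  simp only [randomBits, sem_comp, sem_pair, sem_id, sem_nil, Comp.ret_bind, sem_loop, left_node,
    right_node]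
  induction l with
  | zero =>
    have : uniformBits 0 = PMF.pure (fun i => i.elim0) := by
      ext y
      simp [uniformBits, Subsingleton.elim y fun i => i.elim0]
    rw [this, PMF.pure_map]
    rfl
  | succ l ih =>
    have e : (unary (l + 1)).len = (unary l).len + 1 := rfl
    have h : ∀ b (x : Fin l → Bool), ofBits (Fin.cons b x : Fin (l + 1) → Bool) =
        node (bit b) (ofBits x) := fun b x => by simp [ofBits, List.ofFn_succ, ofList]
    rw [e, Function.iterate_succ_apply', Comp.dist_bind, ih, uniformBits_succ, PMF.map_bind]
    simp only [Function.comp_def, h, PMF.map, PMF.bind_bind, PMF.pure_bind, sem_pair,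
      sem_flip, sem_id, Comp.flip_bind, Comp.ret_bind, Comp.dist]
    rw [PMF.bind_comm]

/-! ### Running times of the operations on bit strings -/

namespace PolyFor

variable {B : Set Behaviour} {c d t : Code}

theorem branch (ht : PolyFor B t) (hc : PolyFor B c) (hd : PolyFor B d) :
    PolyFor B (branch t c d) :=
  ((hc.comp snd).cond (hd.comp snd)).comp (ht.pair id)

theorem bitXor (hc : PolyFor B c) (hd : PolyFor B d) : PolyFor B (bitXor c d) :=
  hc.branch (hd.branch nil (const _)) (hd.branch (const _) nil)

theorem reverse : PolyFor B reverse := by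
  refine snd.comp (.comp (loop ((snd.comp fst).pair ((fst.comp fst).pair snd)) 4 ?_)
    (id.pair (id.pair nil)))
  intro ρ _ s v
  simp only [sem_pair, sem_comp, sem_fst, sem_snd, Comp.ret_bind, Comp.Post, size]
  have := v.size_left_add_right_le
  have := v.left.size_left_add_right_le
  omega

theorem xor : PolyFor B xor := by
  refine reverse.comp ((snd.comp snd).comp (.comp (loop ((snd.comp fst).pair
    ((snd.comp (fst.comp snd)).pair (.pair (.bitXor (fst.comp fst) (fst.comp (fst.comp snd)))
      (snd.comp snd)))) 10 ?_) (fst.pair (fst.pair (snd.pair nil)))))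
  intro ρ _ s v
  simp only [sem_comp, sem_pair, sem_fst, sem_snd, Comp.ret_bind]
  rw [sem_bitXor (a := v.left.left) (b := v.right.left.left) (by simp) (by simp)]
  simp only [Comp.ret_bind, Comp.Post, size]
  have := v.size_left_add_right_le
  have := v.right.size_left_add_right_le
  have := v.left.right_size_le
  have := v.right.left.right_size_le
  have := size_bit_le (v.left.left.toBool ^^ v.right.left.left.toBool)
  omega

theorem double : PolyFor B double := by
  refine .comp (loop (nil.pair id) 2 fun ρ _ s v => ?_) (id.pair id)
  simp only [sem_pair, sem_nil, sem_id, Comp.ret_bind, Comp.Post, size]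
  omega

theorem randomBits : PolyFor B randomBits := by
  refine .comp (loop (flip.pair id) 4 fun ρ _ s v => ?_) (id.pair nil)
  simp only [sem_pair, sem_flip, sem_id, Comp.ret_bind, Comp.flip_bind, Comp.Post, size]
  intro b
  have := size_bit_le b
  omega

end PolyFor

end Code

/-! ### Programs with black-box access to an adversary of the encryption game -/

/-- The answer to an encryption query for `m`, from a sample `a` of the weak PRF. -/
def encAnswer (a m : Val) : Val := node a.left (xorVal a.right m)

theorem size_encAnswer_le (a m : Val) : (encAnswer a m).size ≤ 4 * a.size + 3 := by
  have := size_xorVal_le a.right m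
  simp only [encAnswer, size]
  cases a with
  | leaf =>
    simp_all only [size, left_leaf, right_leaf]
    omega
  | node a b =>
    simp only [size, left_node, right_node] at this ⊢
    omega

/-- How the CPA game with bit `b` is run with samples of the weak PRF in place of the secret key.
The state records whether the challenge messages were submitted, and the log. -/
def replayStep (b : Bool) (s : Bool × Val) (q : Val) : Comp (Val × (Bool × Val)) :=
  (if q.left.toBool = false then Comp.call leaf fun a => .ret (encAnswer a q.right)
    else if s.1 then .ret leaf
    else .call leaf fun a =>
      .ret (encAnswer a (if b then q.right.right else q.right.left))).bind fun a => .ret (a, (s.1 || q.left.toBool, node (node q a) s.2))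

/-- The program that ignores its challenge, runs the whole CPA game with the program `C` on samples
of the weak PRF, and outputs the view of `C`. -/
def replay (C : Behaviour) : Behaviour := fun _ =>
  .flip fun b => ((C leaf).simulate (replayStep b) (false, leaf)).bind fun r =>
    .ret (node r.2.2 r.1)

namespace Code

/-- The answer to an encryption query for the message that `m` returns. -/
def encAns (m : Code) : Code :=
  comp (pair (comp fst fst) (comp xor (pair (comp snd fst) snd))) (pair (comp call nil) m)

theorem sem_encAns {ρ : Behaviour} {m : Code} {v w : Val} (hm : m.sem ρ v = .ret w) :
    (encAns m).sem ρ v = .call leaf fun a => .ret (encAnswer a w) := by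
  simp [encAns, hm, encAnswer]

theorem PolyFor.encAns {B : Set Behaviour} {m : Code} (hm : PolyFor B m) : PolyFor B (encAns m) :=
  .comp (.pair (.comp .fst .fst) (.comp .xor (.pair (.comp .snd .fst) .snd)))
    (.pair (.comp .call .nil) hm)

/-- Answers every message by `leaf`. -/
def leafHandler : Code := pair fst nil

theorem goodHandler_leafHandler : GoodHandler leafHandler where
  polyFor := .pair .fst .nil
  post ρ s st q := by
    simp only [leafHandler, sem_pair, sem_fst, sem_nil, Comp.ret_bind, Comp.Post, left_node,
      right_node, size]
    have := st.left.one_le_size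
    exact ⟨trivial, by omega, by omega⟩

/-- Answers every message, as an encryption query, with a sample of the weak PRF. -/
def encHandler : Code := pair fst (encAns snd)

theorem sem_encHandler (ρ : Behaviour) (st q : Val) : encHandler.sem ρ (node st q) =
    .call leaf fun a => .ret (node st (encAnswer a q)) := by
  simp [encHandler, sem_encAns (m := snd) (v := node st q) rfl]

theorem goodHandler_encHandler : GoodHandler encHandler where
  polyFor := .pair .fst (.encAns .snd)
  post ρ s st q := by
    simp only [sem_encHandler, Comp.Post, left_node, right_node]
    intro a ha
    have := size_encAnswer_le a q
    have := st.left.one_le_size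
    exact ⟨trivial, by omega, by omega⟩

/-- The handler of `reduce`, with state `((b, challenge), used)`. -/
def reduceHandler : Code :=
  branch (comp fst snd)
    (pair fst (encAns (comp snd snd)))
    (pair (pair (comp fst fst) (const (bit true)))
      (branch (comp snd fst)
        (pair (comp fst (comp snd (comp fst fst))) (comp xor (pair (comp snd (comp snd (comp fst fst)))
          (branch (comp fst (comp fst fst)) (comp fst (comp snd snd)) (comp snd (comp snd snd))))))
        nil))

theorem sem_reduceHandler (ρ : Behaviour) (st q : Val) : reduceHandler.sem ρ (node st q) =
    (reduceStep st.left.left.toBool st.left.right st.right.toBool q).bind fun r =>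
      .ret (node (if q.left.toBool then node st.left (bit true) else st) r.1) := by
  have h := sem_encAns (ρ := ρ) (m := comp snd snd) (v := node st q) (w := q.right) (by simp)
  cases hq : q.left.toBool <;> cases hu : st.right.toBool <;> cases hb : st.left.left.toBool <;>
    simp [reduceHandler, reduceStep, hq, hu, hb, h, encAnswer]

theorem goodHandler_reduceHandler : GoodHandler reduceHandler where
  polyFor := .branch (.comp .fst .snd) (.pair .fst (.encAns (.comp .snd .snd)))
    (.pair (.pair (.comp .fst .fst) (.const _)) (.branch (.comp .snd .fst)
      (.pair (.comp .fst (.comp .snd (.comp .fst .fst))) (.comp .xor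
        (.pair (.comp .snd (.comp .snd (.comp .fst .fst)))
        (.branch (.comp .fst (.comp .fst .fst)) (.comp .fst (.comp .snd .snd))
          (.comp .snd (.comp .snd .snd)))))) .nil))
  post ρ s st q := by
    rw [sem_reduceHandler]
    have h1 := st.left.one_le_size
    have h2 : (node st.left (bit true)).size ≤ st.size + 4 := by
      have := st.left_size_le
      simp only [size, bit]
      omega
    simp only [reduceStep]
    split
    · rename_i hq
      simp only [hq, Comp.call_bind, Comp.ret_bind, Comp.Post, left_node, right_node]
      intro a ha
      have := size_encAnswer_le a q.right
      rw [encAnswer] at this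
      exact ⟨by simp, by omega, by simp [add_assoc]⟩
    · rename_i hq
      simp only [Bool.not_eq_false] at hq
      split
      · simp only [Comp.ret_bind, Comp.Post, left_node, right_node, size] at h2 ⊢
        exact ⟨trivial, by omega, by omega⟩
      · simp only [Comp.ret_bind, Comp.Post, left_node, right_node]
        have := size_encAnswer_le st.left.right
          (if st.left.left.toBool then q.right.right else q.right.left)
        rw [encAnswer] at this
        have := st.left.right_size_le
        exact ⟨trivial, by omega, by omega⟩

/-- The handler of `replay`, with state `(b, (used, log))`. -/
def replayHandler : Code :=
  comp
    (pair
      (pair (comp fst (comp fst snd))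
        (pair
          (branch (comp fst (comp snd (comp fst snd)))
            (branch (comp fst (comp snd snd)) nil (const (bit true))) (const (bit true)))
          (pair (pair (comp snd snd) fst) (comp snd (comp snd (comp fst snd))))))
      fst)
    (pair
      (branch (comp fst snd)
        (encAns (comp snd snd))
        (branch (comp fst (comp snd fst))
          (encAns (branch (comp fst fst) (comp fst (comp snd snd)) (comp snd (comp snd snd))))
          nil))
      id)

theorem sem_replayHandler (ρ : Behaviour) (st q : Val) : replayHandler.sem ρ (node st q) =
    (replayStep st.left.toBool (st.right.left.toBool, st.right.right) q).bind fun r =>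
      .ret (node (node st.left (node (bit r.2.1) r.2.2)) r.1) := by
  have h := sem_encAns (ρ := ρ) (m := comp snd snd) (v := node st q) (w := q.right) (by simp)
  have h' := sem_encAns (ρ := ρ) (v := node st q)
    (m := branch (comp fst fst) (comp fst (comp snd snd)) (comp snd (comp snd snd)))
    (w := if st.left.toBool then q.right.right else q.right.left) (by
      cases hb : st.left.toBool <;> simp [hb])
  cases hq : q.left.toBool <;> cases hu : st.right.left.toBool <;> cases hb : st.left.toBool <;>
    simp [replayHandler, replayStep, hq, hu, hb, h, h', bit]

theorem goodHandler_replayHandler : GoodHandler replayHandler where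
  polyFor := .comp (.pair (.pair (.comp .fst (.comp .fst .snd)) (.pair
      (.branch (.comp .fst (.comp .snd (.comp .fst .snd)))
        (.branch (.comp .fst (.comp .snd .snd)) .nil (.const _)) (.const _))
      (.pair (.pair (.comp .snd .snd) .fst) (.comp .snd (.comp .snd (.comp .fst .snd)))))) .fst)
    (.pair (.branch (.comp .fst .snd) (.encAns (.comp .snd .snd))
      (.branch (.comp .fst (.comp .snd .fst)) (.encAns (.branch (.comp .fst .fst)
        (.comp .fst (.comp .snd .snd)) (.comp .snd (.comp .snd .snd)))) .nil)) .id)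
  post ρ s st q := by
    rw [sem_replayHandler]
    have h1 := st.left.one_le_size
    have hst := st.size_left_add_right_le
    have hst' := st.right.size_left_add_right_le
    have key : ∀ ans : Val, ans.size ≤ 7 * s + 1 → ∀ u : Bool,
        (node (node st.left (node (bit u) (node (node q ans) st.right.right))) ans).left.left =
          st.left ∧ ans.size ≤ 10 * (s + st.left.size) ∧
        (node st.left (node (bit u) (node (node q ans) st.right.right))).size ≤
          st.size + 10 * (s + st.left.size) + q.size := by
      intro ans hans u
      have := size_bit_le u
      have := st.right.left.one_le_size
      simp only [size]
      refine ⟨rfl, by omega, ?_⟩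
      omega
    simp only [replayStep]
    split
    · simp only [Comp.call_bind, Comp.ret_bind, Comp.Post]
      intro a ha
      have := a.one_le_size
      exact key _ ((size_encAnswer_le _ _).trans (by omega)) _
    · split
      · simp only [Comp.ret_bind, Comp.Post]
        exact key _ (by simp [size]) _
      · simp only [Comp.call_bind, Comp.ret_bind, Comp.Post]
        intro a ha
        have := a.one_le_size
        exact key _ ((size_encAnswer_le _ _).trans (by omega)) _

end Code

/-! ### Reductions as programs -/

namespace Code

/-- The map `F` on programs is realised by the code `K c`, which gets the input `u` of `c` together
with the challenge, and runs `c` as a subroutine; time grows polynomially. Since `c` receives its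
messages from a good handler, these may be longer than those that `K c` receives. Only the run of `C`
on the empty challenge `leaf` of the CPA game matters for `F C`. -/
structure Realises (K : Code → Code) (F : Behaviour → Behaviour) : Prop where
  apply_leaf : ∀ C x, F C x = F (fun _ => C leaf) x
  sem_eq : ∀ ρ c u x, (K c).sem ρ (node u x) = F (fun _ => c.sem ρ u) x
  withinTime : ∃ P : Polynomial ℕ, ∀ (ρ : Behaviour) (c : Code) (u x : Val) (s t : ℕ),
    (c.eval ρ u).WithinTime (10 * (s + x.size + 10)) t →
    ((K c).eval ρ (node u x)).WithinTime s (P.eval (t + u.size + x.size + s))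

/-- Runs `c` with the handler `h` and the initial state from `pre`, and then `post`. -/
def simulation (pre h post c : Code) : Code := comp post (comp (sim c h) pre)

theorem PolyFor.simulation {B : Set Behaviour} {pre h post c : Code} (hpre : PolyFor B pre)
    (hh : GoodHandler h) (hpost : PolyFor B post) (hc : PolyFor B c) :
    PolyFor B (simulation pre h post c) :=
  hpost.comp ((hc.sim hh).comp hpre)

theorem simulation_withinTime {pre h post : Code} (hpre : PolyFor Set.univ pre)
    (hh : GoodHandler h) (hpost : PolyFor Set.univ post)
    (hu : ∀ ρ u x s, (pre.sem ρ (node u x)).Post s fun w =>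
      w.right = u ∧ w.left.left.size ≤ x.size + 10) :
    ∃ P : Polynomial ℕ, ∀ (ρ : Behaviour) (c : Code) (u x : Val) (s t : ℕ),
      (c.eval ρ u).WithinTime (10 * (s + x.size + 10)) t →
      ((simulation pre h post c).eval ρ (node u x)).WithinTime s
        (P.eval (t + u.size + x.size + s)) := by
  obtain ⟨p₁, h₁⟩ := hpre
  obtain ⟨p₂, h₂⟩ := hh.withinTime
  obtain ⟨p₃, h₃⟩ := hpost
  let Q₁ : Polynomial ℕ := p₁.comp (Polynomial.X + 1)
  let Q₂ : Polynomial ℕ := p₂.comp (Polynomial.X + Q₁)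
  let Q₃ : Polynomial ℕ := p₃.comp (Polynomial.X + Q₂)
  refine ⟨2 * Polynomial.X + 4 + 2 * Q₁ + Q₂ + 2 * Q₃, fun ρ c u x s t hc => ?_⟩
  obtain ⟨N, hN⟩ : ∃ N, N = t + u.size + x.size + s := ⟨_, rfl⟩
  have e₁ : Q₁.eval N = p₁.eval (N + 1) := by simp [Q₁, Polynomial.eval_comp]
  have e₂ : Q₂.eval N = p₂.eval (N + Q₁.eval N) := by simp [Q₂, Polynomial.eval_comp]
  have e₃ : Q₃.eval N = p₃.eval (N + Q₂.eval N) := by simp [Q₃, Polynomial.eval_comp]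
  rw [← hN]
  have b₁ : (pre.eval ρ (node u x)).Bdd s
      (fun w => w.size ≤ Q₁.eval N ∧ w.right = u ∧ w.left.left.size ≤ x.size + 10) (Q₁.eval N) := by
    refine (((h₁ ρ trivial s (node u x)).mono le_rfl ?_).bdd).and_post
      (Comp.post_erase.1 (hu ρ u x s))
    rw [e₁]
    exact eval_mono _ (by simp only [size]; omega)
  have b₂ : ∀ w : Val, (w.size ≤ Q₁.eval N ∧ w.right = u ∧ w.left.left.size ≤ x.size + 10) →
      ((sim c h).eval ρ w).Bdd s (fun r => r.size ≤ Q₂.eval N) (Q₂.eval N) := by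
    rintro w ⟨hw, rfl, hx⟩
    refine ((h₂ ρ c w s t (hc.mono (by omega) le_rfl)).mono le_rfl ?_).bdd
    rw [e₂]
    exact eval_mono _ (by omega)
  have b₃ : ∀ r : Val, r.size ≤ Q₂.eval N →
      (post.eval ρ r).Bdd s (fun r => r.size ≤ Q₃.eval N) (Q₃.eval N) := by
    intro r hr
    refine ((h₃ ρ trivial s r).mono le_rfl ?_).bdd
    rw [e₃]
    exact eval_mono _ (by omega)
  have b₄ : ((comp (sim c h) pre).eval ρ (node u x)).Bdd s (fun r => r.size ≤ Q₂.eval N)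
      (N + 2 + (Q₁.eval N + Q₂.eval N)) :=
    ⟨by simp only [size]; omega, (b₁.bind b₂).mono (fun _ h => h) (by simp only [size]; omega)⟩
  have b₅ : ((simulation pre h post c).eval ρ (node u x)).Bdd s (fun r => r.size ≤ Q₃.eval N)
      (N + 2 + (N + 2 + (Q₁.eval N + Q₂.eval N) + Q₃.eval N)) :=
    ⟨by simp only [size]; omega, (b₄.bind b₃).mono (fun _ h => h) (by simp only [size]; omega)⟩
  refine b₅.withinTime.mono le_rfl ?_
  simp only [Polynomial.eval_add, Polynomial.eval_mul, Polynomial.eval_X, Polynomial.eval_ofNat]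
  have : Q₁.eval N ≤ 2 * Q₁.eval N := by omega
  omega

/-- The code of `reduce`. -/
def reduceCode (c : Code) : Code :=
  simulation (pair (pair (pair flip snd) nil) fst) reduceHandler
    (bitXor snd (comp fst (comp fst fst))) c

theorem realises_reduceCode : Realises reduceCode reduce where
  apply_leaf _ _ := rfl
  withinTime := simulation_withinTime (.pair (.pair (.pair .flip .snd) .nil) .fst)
    goodHandler_reduceHandler (.bitXor .snd (.comp .fst (.comp .fst .fst)))
    fun ρ u x s => by
      simp only [sem_pair, sem_flip, sem_snd, sem_fst, sem_nil, Comp.flip_bind, Comp.ret_bind,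
        Comp.Post, left_node, right_node, size]
      intro b
      have := size_bit_le b
      exact ⟨trivial, by omega⟩
  sem_eq ρ c u x := by
    have h (b : Bool) := Comp.simulate_of_encoding
      (fun used : Bool => node (node (bit b) x) (bit used)) (h := reduceStep b x)
      (h' := fun s m => (reduceHandler.sem ρ (node s m)).bind fun r => .ret (r.right, r.left))
      (fun used q => by
        rw [sem_reduceHandler]
        simp only [left_node, right_node, toBool_bit, Comp.bind_assoc, Comp.ret_bind, reduceStep]
        cases q.left.toBool <;> cases used <;> simp)
      (c.sem ρ u) false
    have h' (st r : Val) : (bitXor snd (comp fst (comp fst fst))).sem ρ (node st r) =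
        .ret (bit (r.toBool ^^ st.left.left.toBool)) :=
      sem_bitXor (by simp) (by simp)
    simp only [reduceCode, simulation, sem_comp, sem_pair, sem_flip, sem_snd, sem_fst, sem_nil,
      Comp.flip_bind, Comp.ret_bind, left_node, right_node, sem_sim, reduce]
    congr 1
    funext b
    have h := h b
    change Comp.simulate _ _ (node (node (bit b) x) leaf) = _ at h
    rw [h]
    simp only [Comp.bind_assoc, Comp.ret_bind, h', left_node, toBool_bit]

/-- The code of `replay`. -/
def replayCode (c : Code) : Code :=
  simulation (pair (pair flip (pair nil nil)) fst) replayHandler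
    (pair (comp snd (comp snd fst)) snd) c

theorem realises_replayCode : Realises replayCode replay where
  apply_leaf _ _ := rfl
  withinTime := simulation_withinTime (.pair (.pair .flip (.pair .nil .nil)) .fst)
    goodHandler_replayHandler (.pair (.comp .snd (.comp .snd .fst)) .snd)
    fun ρ u x s => by
      simp only [sem_pair, sem_flip, sem_fst, sem_nil, Comp.flip_bind, Comp.ret_bind,
        Comp.Post, left_node, right_node]
      intro b
      have := size_bit_le b
      exact ⟨trivial, by omega⟩
  sem_eq ρ c u x := by
    have h (b : Bool) := Comp.simulate_of_encoding
      (fun s : Bool × Val => node (bit b) (node (bit s.1) s.2)) (h := replayStep b)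
      (h' := fun s m => (replayHandler.sem ρ (node s m)).bind fun r => .ret (r.right, r.left))
      (fun s q => by
        rw [sem_replayHandler]
        simp only [left_node, right_node, toBool_bit, Comp.bind_assoc, Comp.ret_bind])
      (c.sem ρ u) (false, leaf)
    simp only [replayCode, simulation, sem_comp, sem_pair, sem_flip, sem_fst, sem_nil, Comp.flip_bind,
      Comp.ret_bind, left_node, right_node, sem_sim, replay]
    congr 1
    funext b
    have h := h b
    change Comp.simulate _ _ (node (bit b) (node leaf leaf)) = _ at h
    rw [h]
    simp only [Comp.bind_assoc, Comp.ret_bind, sem_pair, sem_comp, sem_fst, sem_snd, left_node, right_node]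

/-- The code `K`, applied to the program to which black-box access is given. -/
def blackBox (K : Code → Code) : Code := comp (K subj) (pair nil id)

/-- The code `K`, applied to a program with a hardwired input. -/
def template (K : Code → Code) : Code := comp (K subj) (pair (pair fst nil) snd)

/-- The code `K`, applied to the program described by the data `D`. -/
def wrapData (K : Code → Code) (D : Val) : Val :=
  node ((template K).encodeWith D.left) D.right

/-- The program that computes `wrapData`. -/
def wrap (K : Code → Code) : Code := pair (comp (template K).quote fst) snd

@[simp] theorem sem_wrap (K : Code → Code) (ρ : Behaviour) (D : Val) :
    (wrap K).sem ρ D = .ret (wrapData K D) := by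
  simp [wrap, wrapData]

theorem PolyFor.wrap {B : Set Behaviour} (K : Code → Code) : PolyFor B (wrap K) :=
  ((PolyFor.quote _).comp .fst).pair .snd

theorem withinTime_untick {m : Comp Val} {c s t : ℕ}
    (h : (Comp.tick c m).WithinTime s t) : m.WithinTime s t :=
  h.2.mono le_rfl (by omega)

theorem exists_comp_withinTime {d : Code} (hd : PolyFor Set.univ d) :
    ∃ q : Polynomial ℕ, ∀ (ρ : Behaviour) (c : Code) (v w : Val) (s t : ℕ),
      d.sem ρ v = .ret w → (c.eval ρ w).WithinTime s t →
      ((comp c d).eval ρ v).WithinTime s (q.eval (v.size + s) + 2 * t) := by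
  obtain ⟨p, hp⟩ := hd
  refine ⟨Polynomial.X + 1 + p, fun ρ c v w s t hw hc => ?_⟩
  have h := ((hp ρ trivial s v).bdd.and_post (Q := (· = w)) (Comp.post_erase.1 (by
    rw [← sem, hw]
    rfl))).bind (f := c.eval ρ) fun a ha => ha.2 ▸ hc.bdd
  simp only [eval, Comp.WithinTime, Polynomial.eval_add, Polynomial.eval_X, Polynomial.eval_one]
  exact ⟨by omega, h.withinTime.mono le_rfl (by omega)⟩

namespace Realises

variable {K : Code → Code} {F : Behaviour → Behaviour}

theorem sem_blackBox (hK : Realises K F) (ρ : Behaviour) (x : Val) :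
    (blackBox K).sem ρ x = F (fun y => (ρ y).erase) x := by
  rw [hK.apply_leaf]
  simp [blackBox, hK.sem_eq]

theorem erase_exec_wrapData (hK : Realises K F) (D x : Val) :
    ((wrapData K D).exec x).erase = F (fun y => (D.exec y).erase) x := by
  rw [hK.apply_leaf]
  have : ((wrapData K D).exec x).erase =
      ((template K).subst (decode D.left)).sem noSubj (node D.right x) := by
    rw [← decode_encodeWith]
    rfl
  rw [this, sem_subst]
  simp only [template, sem_comp, sem_pair, sem_fst, sem_nil, sem_snd, Comp.ret_bind, left_node,
    right_node, hK.sem_eq, sem_subj]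
  simp only [sem, Comp.erase_erase, Val.exec]

/-- Black-box access to a reduction with a program that runs in polynomial time. -/
theorem bounded_blackBox (hK : Realises K F) (p : Polynomial ℕ) :
    ∃ p' : Polynomial ℕ, ∀ (n : ℕ) (ρ : Behaviour), Bounded ρ p n →
      Bounded (fun x => ((blackBox K).eval ρ x).untick) p' n := by
  obtain ⟨P, hP⟩ := hK.withinTime
  obtain ⟨q, hq⟩ := exists_comp_withinTime (d := pair nil id) (.pair .nil .id)
  refine ⟨q.comp (2 * Polynomial.X) + 2 * P.comp (2 + p.comp (20 * Polynomial.X + 100) + 1 +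
    2 * Polynomial.X), fun n ρ hρ s x hx =>
    withinTime_untick (c := x.size + 1) (?_ : ((blackBox K).eval ρ x).WithinTime s _)⟩
  have hs : 1 ≤ s := x.one_le_size.trans hx
  have h₁ : (subj.eval ρ leaf).WithinTime (10 * (s + x.size + 10))
      (2 + p.eval (n + 10 * (s + x.size + 10))) :=
    ⟨by simp [size], (hρ _ leaf (by simp only [size]; omega)).mono le_rfl (by simp [size])⟩
  refine (hq ρ (K subj) x (node leaf x) s _ (by simp) (hP ρ subj leaf x s _ h₁)).mono le_rfl ?_
  simp only [Polynomial.eval_add, Polynomial.eval_mul, Polynomial.eval_X, Polynomial.eval_ofNat,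
    Polynomial.eval_comp, Polynomial.eval_one]
  have h₂ := eval_mono q (show x.size + s ≤ 2 * (n + s) by omega)
  have h₃ := eval_mono p (show n + 10 * (s + x.size + 10) ≤ 20 * (n + s) + 100 by omega)
  have h₄ := eval_mono P (show 2 + p.eval (n + 10 * (s + x.size + 10)) + leaf.size + x.size + s ≤
    2 + p.eval (20 * (n + s) + 100) + 1 + 2 * (n + s) by simp only [size]; omega)
  omega

theorem bounded_wrapData (hK : Realises K F) (p : Polynomial ℕ) :
    ∃ p' : Polynomial ℕ, ∀ (n : ℕ) (D : Val), Bounded D.exec p n →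
      Bounded (wrapData K D).exec p' n := by
  obtain ⟨P, hP⟩ := hK.withinTime
  obtain ⟨q, hq⟩ := exists_comp_withinTime (d := pair (pair fst nil) snd) (.pair (.pair .fst .nil) .snd)
  refine ⟨q.comp (p.comp (20 * Polynomial.X + 100) + 2 * Polynomial.X + 1) +
    2 * P.comp (2 * p.comp (20 * Polynomial.X + 100) + 2 * Polynomial.X), fun n D hD s x hx => ?_⟩
  have hs : 1 ≤ s := x.one_le_size.trans hx
  have h₀ := hD (10 * (s + x.size + 10)) leaf (by simp only [size]; omega)
  have hu := size_lt_of_withinTime h₀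
  have e : (wrapData K D).exec x =
      (template K).eval (fun v => ((decode D.left).eval noSubj v).untick) (node D.right x) := by
    rw [← eval_subst, ← decode_encodeWith]
    rfl
  rw [e]
  have h₁ : (subj.eval (fun v => ((decode D.left).eval noSubj v).untick)
      (node D.right leaf)).WithinTime (10 * (s + x.size + 10))
      (p.eval (n + 10 * (s + x.size + 10))) := by
    have : subj.eval (fun v => ((decode D.left).eval noSubj v).untick) (node D.right leaf) =
        D.exec leaf := (eval_eq_tick _ _ _).symm
    rwa [this]
  refine (hq _ (K subj) _ (node (node D.right leaf) x) s _ (by simp)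
    (hP _ subj _ x s _ h₁)).mono le_rfl ?_
  simp only [Polynomial.eval_add, Polynomial.eval_mul, Polynomial.eval_X, Polynomial.eval_ofNat,
    Polynomial.eval_comp, Polynomial.eval_one]
  simp only [size] at hu ⊢
  have h₃ := eval_mono p (show n + 10 * (s + x.size + 10) ≤ 20 * (n + s) + 100 by omega)
  have h₂ := eval_mono q (show D.right.size + x.size + 1 + s ≤
    p.eval (20 * (n + s) + 100) + 2 * (n + s) + 1 by omega)
  have h₄ := eval_mono P (show p.eval (n + 10 * (s + x.size + 10)) + (D.right.size + 1 + 1) +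
    x.size + s ≤ 2 * p.eval (20 * (n + s) + 100) + 2 * (n + s) by omega)
  omega

end Realises

end Code

/-! ### Probabilities -/

theorem prob_nonneg (X : PMF Prop) : 0 ≤ prob X := ENNReal.toReal_nonneg

theorem prob_le_one (X : PMF Prop) : prob X ≤ 1 :=
  ENNReal.toReal_mono ENNReal.one_ne_top (X.coe_le_one _)

open Classical in
theorem prob_pure (P : Prop) : prob (PMF.pure P) = if P then 1 else 0 := by
  by_cases h : P <;> simp [prob, PMF.pure_apply, h]

theorem prob_pure_of {P : Prop} (h : P) : prob (PMF.pure P) = 1 := by rw [prob_pure, if_pos h]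

theorem prob_pure_of_not {P : Prop} (h : ¬ P) : prob (PMF.pure P) = 0 := by
  rw [prob_pure, if_neg h]

variable {α β : Type}

theorem pmf_summable_toReal (X : PMF α) : Summable fun a => (X a).toReal :=
  ENNReal.summable_toReal X.tsum_coe_ne_top

theorem pmf_tsum_toReal (X : PMF α) : ∑' a, (X a).toReal = 1 := by
  rw [← ENNReal.tsum_toReal_eq X.apply_ne_top, X.tsum_coe, ENNReal.toReal_one]

theorem summable_mul_prob (X : PMF α) (f : α → PMF Prop) :
    Summable fun a => (X a).toReal * prob (f a) :=
  (pmf_summable_toReal X).of_nonneg_of_le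
    (fun _ => mul_nonneg ENNReal.toReal_nonneg (prob_nonneg _))
    (fun _ => mul_le_of_le_one_right ENNReal.toReal_nonneg (prob_le_one _))

theorem prob_bind (X : PMF α) (f : α → PMF Prop) :
    prob (X.bind f) = ∑' a, (X a).toReal * prob (f a) := by
  rw [prob, PMF.bind_apply, ENNReal.tsum_toReal_eq fun a =>
    ENNReal.mul_ne_top (X.apply_ne_top a) ((f a).apply_ne_top _)]
  simp [prob, ENNReal.toReal_mul]

/-- Linear inequalities between conditional probabilities can be averaged. -/
theorem prob_bind_le (X : PMF α) (f g h : α → PMF Prop) (c d e : ℝ)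
    (H : ∀ a ∈ X.support, prob (f a) ≤ c * prob (g a) + d * prob (h a) + e) :
    prob (X.bind f) ≤ c * prob (X.bind g) + d * prob (X.bind h) + e := by
  have hg := (summable_mul_prob X g).mul_left c
  have hh := (summable_mul_prob X h).mul_left d
  have he := (pmf_summable_toReal X).mul_left e
  rw [prob_bind, prob_bind, prob_bind, ← tsum_mul_left, ← tsum_mul_left, ← mul_one e,
    ← pmf_tsum_toReal X, ← tsum_mul_left, ← hg.tsum_add hh, ← (hg.add hh).tsum_add he]
  refine (summable_mul_prob X f).tsum_le_tsum (fun a => ?_) ((hg.add hh).add he)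
  by_cases ha : a ∈ X.support
  · nlinarith [mul_le_mul_of_nonneg_left (H a ha) (ENNReal.toReal_nonneg (a := X a))]
  · simp [(PMF.apply_eq_zero_iff X a).2 ha]

theorem prob_bind_mono (X : PMF α) (f g : α → PMF Prop)
    (H : ∀ a ∈ X.support, prob (f a) ≤ prob (g a)) : prob (X.bind f) ≤ prob (X.bind g) := by
  have := prob_bind_le X f g g 1 0 0 fun a ha => by simpa using H a ha
  simpa using this

theorem prob_bind_const (X : PMF α) (f : α → PMF Prop) (c : ℝ)
    (H : ∀ a ∈ X.support, prob (f a) = c) : prob (X.bind f) = c := by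
  rw [prob_bind, ← mul_one c, ← pmf_tsum_toReal X, ← tsum_mul_left]
  refine tsum_congr fun a => ?_
  by_cases ha : a ∈ X.support
  · rw [H a ha, mul_comm]
  · simp [(PMF.apply_eq_zero_iff X a).2 ha]

theorem prob_map_mono (X : PMF α) (P Q : α → Prop) (H : ∀ a ∈ X.support, P a → Q a) :
    prob (X.map P) ≤ prob (X.map Q) := by
  refine prob_bind_mono X _ _ fun a ha => ?_
  simp only [Function.comp_apply, prob_pure]
  split_ifs with h1 h2
  · exact le_rfl
  · exact absurd (H a ha h1) h2
  · exact zero_le_one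
  · exact le_rfl

theorem prob_uniform_bool (f : Bool → PMF Prop) :
    prob ((PMF.uniformOfFintype Bool).bind f) = (prob (f false) + prob (f true)) / 2 := by
  rw [prob_bind, tsum_fintype, Fintype.sum_bool]
  simp only [PMF.uniformOfFintype_apply, Fintype.card_bool]
  norm_num
  ring

theorem uniformBits_map_xor {l : ℕ} (t : Fin l → Bool) :
    (uniformBits l).map (fun z i => z i ^^ t i) = uniformBits l := by
  ext y
  rw [PMF.map_apply, tsum_eq_single (fun i => y i ^^ t i)]
  · simp [uniformBits]
  · intro x hx
    rw [if_neg]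
    rintro rfl
    exact hx (by simp)

/-! ### The games -/

theorem xorVal_ofBits {l : ℕ} (y : Fin l → Bool) (m : Val) :
    xorVal (ofBits y) m = ofBits fun i => y i ^^ toBits l m i := by
  induction l generalizing m with
  | zero => simp [ofBits, ofList, xorVal]
  | succ l ih =>
    simp only [ofBits, List.ofFn_succ, ofList, xorVal] at ih ⊢
    rw [ih]
    simp [toBits]

theorem toBits_ofBits {l : ℕ} (x : Fin l → Bool) : toBits l (ofBits x) = x := by
  funext i
  induction l with
  | zero => exact i.elim0
  | succ l ih =>
    have e : ofBits x = node (bit (x 0)) (ofBits fun i => x i.succ) := by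
      simp [ofBits, List.ofFn_succ, ofList]
    rw [e]
    refine Fin.cases ?_ (fun j => ?_) i
    · simp [toBits]
    · simpa [toBits] using ih (fun i => x i.succ) j

variable (W : WMPRF)

theorem encVal_toCPA (n : ℕ) (sk m : Val) :
    W.toCPA.encVal n sk m = (W.sample n sk leaf).map fun a => encAnswer a m := by
  simp only [WMSKE.encVal, WMPRF.toCPA, WMPRF.sample, PMF.map_comp]
  congr 1
  funext x
  simp [encAnswer, xorVal_ofBits]

/-- The answers of `reduceStep`, with samples `S` and a fixed challenge. -/
def eagerOracle (S : PMF Val) (chal : Val) (b used : Bool) (q : Val) : PMF (Val × Bool) :=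
  if q.left.toBool = false then S.map fun a => (encAnswer a q.right, used)
  else if used then PMF.pure (leaf, true)
  else PMF.pure (encAnswer chal (if b then q.right.right else q.right.left), true)

/-- The answers of `reduceStep`, with samples `S`, and a challenge that is drawn from `X` only when
the challenge messages are submitted. -/
def lazyOracle (S X : PMF Val) (b used : Bool) (q : Val) : PMF (Val × Bool) :=
  if q.left.toBool = false then S.map fun a => (encAnswer a q.right, used)
  else if used then PMF.pure (leaf, true)
  else X.map fun chal => (encAnswer chal (if b then q.right.right else q.right.left), true)

theorem runOracle_eager_used (S X : PMF Val) (chal : Val) (b : Bool) (m : Comp α) :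
    m.runOracle (eagerOracle S chal b) true = m.runOracle (lazyOracle S X b) true := by
  induction m with
  | ret a => rfl
  | flip k ih => simp only [Comp.runOracle, ih]
  | tick c m ih => simpa only [Comp.runOracle] using ih
  | call q k ih =>
    simp only [Comp.runOracle, eagerOracle, lazyOracle]
    split
    · simp only [PMF.bind_map]
      congr 1
      funext a
      exact ih _
    · simpa using ih _

/-- The challenge is used at most once, so it can be drawn when it is used. -/
theorem bind_runOracle_eager (S X : PMF Val) (b : Bool) (m : Comp α) :
    (X.bind fun chal => (m.runOracle (eagerOracle S chal b) false).map Prod.fst) =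
      (m.runOracle (lazyOracle S X b) false).map Prod.fst := by
  induction m with
  | ret a => simp [Comp.runOracle, PMF.pure_map]
  | flip k ih =>
    simp only [Comp.runOracle, PMF.map_bind, ← ih]
    rw [PMF.bind_comm]
  | tick c m ih => simpa only [Comp.runOracle] using ih
  | call q k ih =>
    simp only [Comp.runOracle, PMF.map_bind]
    cases hq : q.left.toBool
    · simp only [eagerOracle, lazyOracle, hq, if_true, PMF.bind_map, Function.comp_def]
      rw [PMF.bind_comm]
      simp only [ih]
    · simp [eagerOracle, lazyOracle, hq, Function.comp_def, PMF.bind_map, runOracle_eager_used S X]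

theorem map_runOracle_reduce (n : ℕ) (sk : Val) (C : Behaviour) (chal : Val) :
    ((reduce C chal).runOracle (logged (W.sample n sk)) leaf).map Prod.fst =
      (PMF.uniformOfFintype Bool).bind fun b =>
        ((C leaf).runOracle (eagerOracle (W.sample n sk leaf) chal b) false).map fun r =>
          bit (r.1.toBool ^^ b) := by
  simp only [reduce, Comp.runOracle, PMF.map_bind, Comp.runOracle_bind, PMF.pure_map]
  congr 1
  funext b
  have h := Comp.runOracle_projection_fst Prod.fst
    (O' := Comp.handlerOracle (logged (W.sample n sk)) (reduceStep b chal))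
    (O := eagerOracle (W.sample n sk leaf) chal b)
    (fun s q => by
      simp only [Comp.handlerOracle, reduceStep, eagerOracle]
      split_ifs
      all_goals simp only [Comp.runOracle, PMF.map_bind, PMF.bind_map, PMF.pure_map,
        logged, Function.comp_def, Prod.map]
      all_goals rfl) (C leaf) (false, leaf)
  have h' := congrArg (PMF.map fun v : Val => bit (v.toBool ^^ b)) h
  simp only [PMF.map_comp] at h'
  refine Eq.trans ?_ h'
  rw [Comp.runOracle_simulate, PMF.bind_map]
  rfl

theorem map_runOracle_challenger (n : ℕ) (sk : Val) (b : Bool) (m : Comp α) :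
    (m.runOracle (W.toCPA.challenger n sk b) (false, leaf)).map Prod.fst =
      (m.runOracle (lazyOracle (W.sample n sk leaf) (W.sample n sk leaf) b) false).map Prod.fst :=
  Comp.runOracle_projection_fst Prod.fst
    (fun s q => by
      simp only [WMSKE.challenger, lazyOracle, encVal_toCPA]
      cases hq : q.left.toBool <;> cases hs : s.1 <;>
        simp [PMF.map_comp, Function.comp_def, PMF.pure_map, Prod.map]) m _

/-- The challenge of the weak PRF game with bit `b'`. -/
def challenge (n : ℕ) (sk : Val) (b' : Bool) : PMF Val :=
  (uniformBits (W.len n)).bind fun x => (uniformBits (W.len n)).map fun z =>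
    node (ofBits x) (ofBits (if b' then z else W.eval n sk x))

theorem challenge_false (n : ℕ) (sk : Val) : challenge W n sk false = W.sample n sk leaf := by
  simp only [challenge, WMPRF.sample, PMF.map, Function.comp_def, if_false, Bool.false_eq_true,
    PMF.bind_const]

/-- Encryption with a random pad hides the message. -/
theorem challenge_true_map_encAnswer (n : ℕ) (sk m : Val) :
    (challenge W n sk true).map (fun a => encAnswer a m) = challenge W n sk true := by
  simp only [challenge, PMF.map_bind, PMF.map_comp, if_true]
  congr 1
  funext x
  conv_rhs => rw [← uniformBits_map_xor (toBits (W.len n) m), PMF.map_comp]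
  congr 1
  funext z
  simp [encAnswer, xorVal_ofBits]

theorem lazyOracle_challenge_true (S : PMF Val) (n : ℕ) (sk : Val) (b : Bool) :
    lazyOracle S (challenge W n sk true) b = lazyOracle S (challenge W n sk true) false := by
  have h : ∀ m, (challenge W n sk true).map (fun a => (encAnswer a m, true)) =
      (challenge W n sk true).map fun a => (a, true) := fun m => by
    conv_rhs => rw [← challenge_true_map_encAnswer W n sk m, PMF.map_comp]
    rfl
  funext used q
  simp only [lazyOracle, h]

theorem win_reduce (n : ℕ) (sk : Val) (C : Behaviour) :
    W.game.win n sk (reduce C) = (PMF.uniformOfFintype Bool).bind fun b' =>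
      (PMF.uniformOfFintype Bool).bind fun b =>
        (((C leaf).runOracle
          (lazyOracle (W.sample n sk leaf) (challenge W n sk b') b) false).map Prod.fst).map
          fun v => (v.toBool ^^ b) = b' := by
  have h₁ : ∀ (chal : Val) (b' : Bool),
      ((reduce C chal).runOracle (logged (W.sample n sk)) leaf).map (fun r => r.1.toBool = b') =
        (PMF.uniformOfFintype Bool).bind fun b =>
          (((C leaf).runOracle (eagerOracle (W.sample n sk leaf) chal b) false).map Prod.fst).map
            fun v => (v.toBool ^^ b) = b' := by
    intro chal b'
    have := congrArg (PMF.map fun v : Val => v.toBool = b') (map_runOracle_reduce W n sk C chal)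
    simp only [PMF.map_comp, PMF.map_bind, Function.comp_def, toBool_bit] at this
    simp only [PMF.map_comp, Function.comp_def, this]
  have h₂ : W.game.win n sk (reduce C) = (PMF.uniformOfFintype Bool).bind fun b' =>
      (challenge W n sk b').bind fun chal =>
        ((reduce C chal).runOracle (logged (W.sample n sk)) leaf).map
          fun r => r.1.toBool = b' := by
    simp only [WMPRF.game, WMPRF.experiment, PMF.map_bind, PMF.map_comp, challenge, PMF.bind_bind,
      PMF.bind_map, Function.comp_def]
  rw [h₂]
  congr 1
  funext b'
  simp only [h₁]
  rw [PMF.bind_comm]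
  congr 1
  funext b
  rw [← bind_runOracle_eager, PMF.map_bind]

/-- The reduction wins the weak PRF game with half the advantage: with a pseudorandom challenge it
wins like its CPA adversary, and with a random challenge the bit `b` is hidden perfectly. -/
theorem prob_win_reduce (n : ℕ) (sk : Val) (C : Behaviour) :
    prob (W.game.win n sk (reduce C)) = prob (W.toCPA.game.win n sk C) / 2 + 1 / 4 := by
  have hxor : ∀ a b : Bool, ((a ^^ b) = false) = (a = b) := by
    intro a b
    cases a <;> cases b <;> simp
  have h₁ : W.toCPA.game.win n sk C = (PMF.uniformOfFintype Bool).bind fun b =>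
      (((C leaf).runOracle (lazyOracle (W.sample n sk leaf) (challenge W n sk false) b)
        false).map Prod.fst).map fun v => (v.toBool ^^ b) = false := by
    simp only [challenge_false, ← map_runOracle_challenger]
    simp only [WMSKE.game, WMSKE.experiment, PMF.map_bind, PMF.map_comp, Function.comp_def,
      hxor]
  rw [win_reduce, prob_uniform_bool, ← h₁]
  simp only [lazyOracle_challenge_true]
  have h₂ := prob_bind_const
    (((C leaf).runOracle (lazyOracle (W.sample n sk leaf) (challenge W n sk true) false)
      false).map Prod.fst)
    (fun v => (PMF.uniformOfFintype Bool).bind fun b => PMF.pure ((v.toBool ^^ b) = true)) (1 / 2)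
    (fun v _ => by rw [prob_uniform_bool]; cases v.toBool <;> simp [prob_pure])
  rw [PMF.bind_comm] at h₂
  have h₃ : prob ((PMF.uniformOfFintype Bool).bind fun b => PMF.map
      (fun v => (v.toBool ^^ b) = true)
      (((C leaf).runOracle (lazyOracle (W.sample n sk leaf) (challenge W n sk true) false)
      false).map Prod.fst)) = 1 / 2 := h₂
  rw [h₃]
  ring

theorem good_reduce (n k : ℕ) (sk : Val) (C : Behaviour) (h : Good W.toCPA.game n k sk C) :
    Good W.game n (2 * k) sk (reduce C) := by
  rw [Good, prob_win_reduce]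
  rw [Good] at h
  have : (1 : ℝ) / ((2 * k : ℕ) : ℝ) = 1 / k / 2 := by
    push_cast
    rw [div_div, mul_comm]
  rw [this]
  linarith

/-- The output of `replay` in the weak PRF game is the view of the CPA adversary, whatever the
challenge is. -/
theorem view_replay (n : ℕ) (sk : Val) (C : Behaviour) :
    (W.game.view n sk (replay C)).map (fun v => v.right.right) = W.toCPA.game.view n sk C := by
  have h : ∀ chal : Val, ((replay C chal).runOracle (logged (W.sample n sk)) leaf).map Prod.fst =
      W.toCPA.game.view n sk C := by
    intro chal
    simp only [replay, Comp.runOracle, PMF.map_bind, Comp.runOracle_bind, PMF.pure_map,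
      WMSKE.game, WMSKE.experiment, PMF.map_comp]
    congr 1
    funext b
    have h := Comp.runOracle_projection Prod.fst
      (O' := Comp.handlerOracle (logged (W.sample n sk)) (replayStep b))
      (O := W.toCPA.challenger n sk b)
      (fun s q => by
        simp only [Comp.handlerOracle, replayStep, WMSKE.challenger, encVal_toCPA]
        split_ifs
        all_goals simp only [Comp.runOracle, Comp.call_bind, Comp.ret_bind, PMF.map_bind,
          PMF.bind_map, PMF.pure_map, PMF.map_comp, logged, Function.comp_def, Prod.map]
        all_goals rfl) (C leaf) ((false, leaf), leaf)
    have h' := congrArg (PMF.map fun r : Val × (Bool × Val) => node r.2.2 r.1) h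
    simp only [PMF.map_comp] at h'
    refine Eq.trans ?_ h'
    rw [Comp.runOracle_simulate, PMF.bind_map]
    rfl
  simp only [WMPRF.game, WMPRF.experiment, PMF.map_bind, PMF.map_comp, Function.comp_def,
    right_node]
  have h' : ∀ chal : Val, ((replay C chal).runOracle (logged (W.sample n sk)) leaf).map
      (fun r => r.1) = W.toCPA.game.view n sk C := h
  simp only [h', PMF.bind_const]

/-! ### Unremovability -/

theorem win_erase (n : ℕ) (sk : Val) (C : Behaviour) :
    W.game.win n sk (fun x => (C x).erase) = W.game.win n sk C := by
  simp only [WMPRF.game, WMPRF.experiment, Comp.runOracle_erase]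

theorem view_erase (n : ℕ) (sk : Val) (C : Behaviour) :
    W.game.view n sk (fun x => (C x).erase) = W.game.view n sk C := by
  simp only [WMPRF.game, WMPRF.experiment, Comp.runOracle_erase]

theorem win_erase_toCPA (n : ℕ) (sk : Val) (C : Behaviour) :
    W.toCPA.game.win n sk (fun x => (C x).erase) = W.toCPA.game.win n sk C := by
  simp only [WMSKE.game, WMSKE.experiment, Comp.runOracle_erase]

theorem view_erase_toCPA (n : ℕ) (sk : Val) (C : Behaviour) :
    W.toCPA.game.view n sk (fun x => (C x).erase) = W.toCPA.game.view n sk C := by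
  simp only [WMSKE.game, WMSKE.experiment, Comp.runOracle_erase]

theorem Adversary.runOracle_run {σ : Type} (A : Adversary) (n : ℕ) (aux : Val)
    (O : σ → Val → PMF (Val × σ)) (s : σ) :
    (A.run n aux).runOracle O s =
      (A.code.sem noSubj (node (node (unary n) (A.advice n)) aux)).runOracle O s :=
  (Comp.runOracle_erase O _ s).symm

/-- The adversary that turns the output `D` of `A` into `wrapData K D`. -/
def Adversary.wrap (A : Adversary) (K : Code → Code) : Adversary where
  code := .comp (Code.wrap K) A.code
  polyTime := Code.polyFor_noSubj.1 (.comp (.wrap K) (Code.polyFor_noSubj.2 A.polyTime))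
  advice := A.advice
  advice_poly := A.advice_poly

theorem Adversary.runOracle_wrap {σ : Type} (A : Adversary) (K : Code → Code) (n : ℕ) (aux : Val)
    (O : σ → Val → PMF (Val × σ)) (s : σ) :
    ((A.wrap K).run n aux).runOracle O s =
      ((A.run n aux).runOracle O s).map (Prod.map (Code.wrapData K) _root_.id) := by
  rw [runOracle_run, runOracle_run]
  simp only [Adversary.wrap, Code.sem_comp, Comp.runOracle_bind, Code.sem_wrap, Comp.runOracle]
  rfl

theorem good_wrapData (n k : ℕ) (sk D : Val) (h : Good W.toCPA.game n k sk D.exec) :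
    Good W.game n (2 * k) sk (Code.wrapData Code.reduceCode D).exec := by
  rw [Good, ← win_erase_toCPA] at h
  have := good_reduce W n k sk _ h
  rw [← funext (Code.realises_reduceCode.erase_exec_wrapData D), Good, win_erase] at this
  exact this

theorem unremovable_toCPA (pub : Bool) (q : ℕ → ℕ∞) (k : ℕ → ℕ)
    (h : Unremovable W.toScheme W.game pub q fun n => 2 * k n) :
    Unremovable W.toCPA.toScheme W.toCPA.game pub q k := by
  intro A p
  obtain ⟨p', hp'⟩ := Code.realises_reduceCode.bounded_wrapData p
  obtain ⟨ε, hε, H⟩ := h (A.wrap Code.reduceCode) p'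
  refine ⟨ε, hε, fun n => le_trans ?_ (H n)⟩
  refine prob_bind_mono _ _ _ fun key _ => ?_
  rw [Adversary.runOracle_wrap, PMF.bind_map]
  refine prob_bind_mono (((A.run n (pubInfo pub key.2.1)).runOracle
    (markOracle W.toScheme q n key.2.2 key.1) [])) _ _ fun r _ => ?_
  simp only [Function.comp_apply, Prod.map, _root_.id]
  rw [funext (Code.realises_reduceCode.erase_exec_wrapData r.1)]
  exact prob_map_mono _ _ _ fun out _ ho =>
    ⟨ho.1, hp' n _ ho.2.1, good_wrapData W n (k n) key.1 r.1 ho.2.2⟩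

/-! ### Security with the game -/

/-- The weak PRF adversary that runs the CPA adversary `A`. -/
def Adversary.reduce (A : Adversary) : Adversary where
  code := .comp (Code.reduceCode A.code)
    (.pair (.pair .fst (.pair (.comp .fst .snd) .nil)) (.comp .snd .snd))
  polyTime := Code.polyFor_noSubj.1 (.comp
    (.simulation (.pair (.pair (.pair .flip .snd) .nil) .fst) Code.goodHandler_reduceHandler
      (.bitXor .snd (.comp .fst (.comp .fst .fst))) (Code.polyFor_noSubj.2 A.polyTime))
    (.pair (.pair .fst (.pair (.comp .fst .snd) .nil)) (.comp .snd .snd)))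
  advice := A.advice
  advice_poly := A.advice_poly

theorem Adversary.erase_run_reduce (A : Adversary) (n : ℕ) (aux chal : Val) :
    (A.reduce.run n (node aux chal)).erase =
      WM.reduce (fun c => (A.run n (node aux c)).erase) chal := by
  have : (A.reduce.run n (node aux chal)).erase =
      A.reduce.code.sem noSubj (node (node (unary n) (A.advice n)) (node aux chal)) := rfl
  rw [this]
  simp only [Adversary.reduce, Code.sem_comp, Code.sem_pair, Code.sem_fst, Code.sem_snd,
    Code.sem_nil, Comp.ret_bind, left_node, right_node, Code.realises_reduceCode.sem_eq]
  rfl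

theorem Negligible.const_mul {ε : ℕ → ℝ} (h : Negligible ε) (c : ℝ) :
    Negligible fun n => c * ε n :=
  Asymptotics.SuperpolynomialDecay.const_mul h c

theorem Negligible.add {ε δ : ℕ → ℝ} (h : Negligible ε) (h' : Negligible δ) :
    Negligible fun n => ε n + δ n :=
  Asymptotics.SuperpolynomialDecay.add h h'

theorem gameSecure_toCPA (pub : Bool) (h : GameSecure W.toScheme W.game pub) :
    GameSecure W.toCPA.toScheme W.toCPA.game pub := by
  intro A
  obtain ⟨ε, hε, H⟩ := h A.reduce
  refine ⟨fun n => 2 * ε n, hε.const_mul 2, fun n => ?_⟩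
  have key : ∀ key : Val × Val × Val,
      prob (W.toCPA.game.win n key.1 fun chal => A.run n (node (pubInfo pub key.2.1) chal)) =
      2 * prob (W.game.win n key.1 fun chal =>
        A.reduce.run n (node (pubInfo pub key.2.1) chal)) - 1 / 2 := by
    intro key
    rw [← win_erase, funext (A.erase_run_reduce n (pubInfo pub key.2.1)), prob_win_reduce,
      win_erase_toCPA W n key.1 fun chal => A.run n (node (pubInfo pub key.2.1) chal)]
    ring
  have := prob_bind_le (W.setup n)
    (fun key => W.toCPA.game.win n key.1 fun chal => A.run n (node (pubInfo pub key.2.1) chal))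
    (fun key => W.game.win n key.1 fun chal => A.reduce.run n (node (pubInfo pub key.2.1) chal))
    (fun key => W.game.win n key.1 fun chal => A.reduce.run n (node (pubInfo pub key.2.1) chal))
    2 0 (-(1 / 2)) fun a _ => by rw [key]; linarith
  refine this.trans ?_
  have := H n
  linarith

/-! ### Functionality -/

theorem dec_enc_toCPA (n : ℕ) (sk : Val) (m : Fin (W.len n) → Bool) (c : Val)
    (hc : c ∈ (W.toCPA.enc n sk m).support) : W.toCPA.dec n sk c = m := by
  simp only [WMPRF.toCPA, PMF.support_map, Set.mem_image] at hc
  obtain ⟨r, -, rfl⟩ := hc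
  funext i
  simp [WMPRF.toCPA, toBits_ofBits]

theorem functionalityPreserving_toCPA (h : W.FunctionalityPreserving) :
    W.toCPA.FunctionalityPreserving := by
  obtain ⟨ε, hε, H⟩ := h
  refine ⟨ε, hε, fun n τ hτ => ⟨fun m => ?_, fun c => ?_⟩⟩
  · have h₀ : 0 ≤ ε n := by
      have := (H n (fun _ => false) τ hτ).trans (prob_le_one _)
      linarith
    refine (show 1 - ε n ≤ 1 by linarith).trans_eq (Eq.symm ?_)
    exact prob_bind_const _ _ 1 fun key _ => prob_bind_const _ _ 1 fun skt _ =>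
      prob_bind_const _ _ 1 fun c hc => prob_bind_const _ _ 1 fun c' hc' =>
        prob_pure_of ⟨dec_enc_toCPA W n skt m c' hc', dec_enc_toCPA W n key.1 m c hc⟩
  · refine (H n (toBits (W.len n) c.left) τ hτ).trans
      (prob_bind_mono _ _ _ fun key _ => prob_map_mono _ _ _ fun skt _ he => ?_)
    funext i
    simp only [WMPRF.toCPA, he]

/-! ### Simulation by the extraction key -/

theorem Indist.map {X Y : ℕ → PMF Val} {quality : SimQuality} (h : Indist X Y quality) (c : Code)
    (hc : c.PolyTime) (f : Val → Val) (hf : ∀ v, c.sem noSubj v = .ret (f v)) :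
    Indist (fun n => (X n).map f) (fun n => (Y n).map f) quality := by
  cases quality with
  | perfect =>
    have h : X = Y := h
    rw [h]
    rfl
  | statistical =>
    obtain ⟨ε, hε, H⟩ := h
    refine ⟨ε, hε, fun n E => ?_⟩
    rw [PMF.toOuterMeasure_map_apply, PMF.toOuterMeasure_map_apply]
    exact H n _
  | computational =>
    intro Z
    obtain ⟨ε, hε, H⟩ := h
      { code := .comp Z.code (.pair .fst (.comp c .snd))
        polyTime := Code.polyFor_noSubj.1 (.comp (Code.polyFor_noSubj.2 Z.polyTime)
          (.pair .fst (.comp (Code.polyFor_noSubj.2 hc) .snd)))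
        advice := Z.advice
        advice_poly := Z.advice_poly }
    refine ⟨ε, hε, fun n => ?_⟩
    have e : ∀ X : PMF Val, (X.map f).bind (fun v => (Z.run n v).dist.map fun g => g.toBool = true) =
        X.bind fun v => ((Z.code.comp (.pair .fst (.comp c .snd))).eval noSubj
          (node (node (unary n) (Z.advice n)) v)).dist.map fun g => g.toBool = true := by
      intro X
      rw [PMF.bind_map]
      congr 1
      funext v
      simp only [Function.comp_apply, Adversary.run]
      rw [← Code.dist_sem, ← Code.dist_sem]
      simp [hf]
    rw [e, e]
    exact H n

/-- The first stage adversary of the weak PRF game that runs `A` with ciphertexts made from samples,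
and has the resulting program replay the CPA game. -/
def Adversary.replay (A : Adversary) : Adversary :=
  Adversary.wrap
    { code := .comp .snd (.comp (.sim A.code Code.encHandler) (.pair .nil .id))
      polyTime := Code.polyFor_noSubj.1 (.comp .snd (.comp
        (.sim (Code.polyFor_noSubj.2 A.polyTime) Code.goodHandler_encHandler) (.pair .nil .id)))
      advice := A.advice
      advice_poly := A.advice_poly } Code.replayCode

theorem stageOne_replay (A : Adversary) (n : ℕ) (sk aux : Val) :
    stageOne W.game A.replay n sk aux =
      (stageOne W.toCPA.game A n sk aux).map (Code.wrapData Code.replayCode) := by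
  simp only [stageOne, Adversary.replay, Adversary.runOracle_wrap, PMF.map_comp]
  rw [Adversary.runOracle_run, Adversary.runOracle_run]
  simp only [Code.sem_comp, Code.sem_pair, Code.sem_nil, Code.sem_id, Comp.ret_bind, Code.sem_sim,
    right_node, left_node, Code.sem_snd, Code.sem_encHandler, Comp.call_bind, Comp.bind_assoc]
  have h := Comp.runOracle_projection_fst (fun _ : Val × Unit => ())
    (O' := Comp.handlerOracle
      (fun (_ : Unit) m => (W.game.oracle n sk m).map fun a => (a, ()))
      fun s m => .call leaf fun a => .ret (encAnswer a m, s))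
    (O := fun (_ : Unit) m => (W.toCPA.game.oracle n sk m).map fun a => (a, ()))
    (fun s q => by
      simp only [Comp.handlerOracle, Comp.runOracle, WMPRF.game, WMSKE.game, encVal_toCPA,
        PMF.bind_map, PMF.map_bind, PMF.pure_map, PMF.map_comp, Function.comp_def, Prod.map]
      rfl)
    (A.code.sem noSubj (node (node (unary n) (A.advice n)) aux)) (leaf, ())
  have h' := congrArg (PMF.map (Code.wrapData Code.replayCode)) h
  simp only [PMF.map_comp] at h'
  refine Eq.trans ?_ h'
  rw [Comp.runOracle_bind, Comp.runOracle_simulate, PMF.bind_map, PMF.map_bind]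
  simp only [Comp.runOracle, PMF.pure_map, Function.comp_apply]
  rfl

theorem Code.blackBoxPolyTime_subst {c : Code} (hc : c.BlackBoxPolyTime) {K : Code → Code}
    {F : Behaviour → Behaviour} (hK : Realises K F) :
    (c.subst (blackBox K)).BlackBoxPolyTime := by
  intro p
  obtain ⟨p₁, h₁⟩ := hK.bounded_blackBox p
  obtain ⟨p₂, h₂⟩ := hc p₁
  refine ⟨p₂, fun n ρ hρ v => ?_⟩
  rw [eval_subst]
  exact h₂ n _ (h₁ n ρ hρ) v

theorem Code.blackBoxPolyTime_comp {c d : Code} (hc : c.BlackBoxPolyTime)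
    (hd : PolyFor Set.univ d) : (comp d c).BlackBoxPolyTime := by
  intro p
  obtain ⟨p₁, h₁⟩ := hc p
  obtain ⟨p₂, h₂⟩ := hd
  refine ⟨2 * p₁ + 2 * p₂.comp (p₁ + 1), fun n ρ hρ v => ?_⟩
  have h := (h₁ n ρ hρ v).bdd.bind (f := d.eval ρ) fun a ha =>
    ((h₂ ρ trivial 1 a).mono le_rfl (eval_mono p₂ (Nat.add_le_add_right ha 1))).bdd
  have := size_lt_of_withinTime (h₁ n ρ hρ v)
  simp only [eval, Comp.WithinTime, Polynomial.eval_add, Polynomial.eval_one, Polynomial.eval_mul,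
    Polynomial.eval_ofNat, Polynomial.eval_comp]
  exact ⟨by omega, h.withinTime.mono le_rfl (by omega)⟩

theorem keySimulation_toCPA (pub : Bool) (quality : SimQuality)
    (h : KeySimulation W.toScheme W.game pub quality) :
    KeySimulation W.toCPA.toScheme W.toCPA.game pub quality := by
  obtain ⟨Sim, hSim, H⟩ := h
  have hsnd : Code.PolyFor Set.univ (.comp .snd .snd) := .comp .snd .snd
  refine ⟨.comp (.comp .snd .snd) (Sim.subst (Code.blackBox Code.replayCode)),
    Code.blackBoxPolyTime_comp (Code.blackBoxPolyTime_subst hSim Code.realises_replayCode) hsnd,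
    fun A ⟨p, hp⟩ => ?_⟩
  obtain ⟨p', hp'⟩ := Code.realises_replayCode.bounded_wrapData p
  have h := (H A.replay ⟨p', fun n key hkey D hD => by
    rw [stageOne_replay, PMF.support_map] at hD
    obtain ⟨D, hD, rfl⟩ := hD
    exact hp' n D (hp n key hkey D hD)⟩).map (.comp .snd .snd)
      (Code.polyFor_noSubj.1 (hsnd.mono (Set.subset_univ _))) (fun v => v.right.right)
      (fun v => by simp)
  convert h using 1
  · funext n
    simp only [stageOne_replay, PMF.map_bind, PMF.bind_map]
    congr 1
    funext key
    congr 1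
    funext D
    simp only [Function.comp_apply]
    rw [← view_erase, funext (Code.realises_replayCode.erase_exec_wrapData D), view_replay,
      view_erase_toCPA W n key.1 D.exec]
  · funext n
    simp only [stageOne_replay, PMF.map_bind, PMF.bind_map]
    congr 1
    funext key
    congr 1
    funext D
    simp only [Function.comp_apply]
    rw [← Code.dist_sem, ← Code.dist_sem, Code.sem_comp, Code.sem_subst, Comp.dist_bind]
    have e : Sim.sem ((Code.blackBox Code.replayCode).sem D.exec) =
        Sim.sem (Code.wrapData Code.replayCode D).exec :=
      Code.sem_congr (fun v => by
        rw [Code.realises_replayCode.erase_exec_wrapData,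
          ← Code.realises_replayCode.sem_blackBox, Code.sem, Comp.erase_erase]) Sim
    rw [e]
    simp only [Code.sem_comp, Code.sem_snd, Comp.ret_bind, Comp.dist]
    rfl

/-! ### Meaningfulness -/

/-- The handler of `keyed`. -/
def keyedStep (G : Game) (n : ℕ) (sk : Val) (_ : Unit) (m : Val) : Comp (Val × Unit) :=
  if m.left.toBool then .ret (G.secEval n sk m.right, ())
  else .call m.right fun a => .ret (a, ())

theorem erase_keyed (G : Game) (T : Code) (n : ℕ) (sk x : Val) :
    (keyed G T n sk x).erase = ((T.sem noSubj (node (unary n) x)).simulate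
      (keyedStep G n sk) ()).bind fun r => .ret r.1 := by
  rw [keyed, Comp.erase_bind, Comp.erase_simulate]
  congr 2
  funext u m
  rw [keyedStep]
  split_ifs <;> rfl

/-- How a program with a built-in key of the weak PRF, which runs a program with a built-in
decryption key, answers the messages of the latter. A message `(_, c)` that asks for the decryption
of `c` needs one evaluation of the weak PRF; other messages belong to the CPA game. -/
def decryptStep (b : Bool) (chal : Val) (used : Bool) (m : Val) : Comp (Val × Bool) :=
  if m.left.toBool then
    .call (node (bit true) m.right.left) fun a => .ret (xorVal a m.right.right, used)
  else reduceStep b chal used m.right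

namespace Code

/-- The handler with answers `decryptStep` and state `((b, challenge), used)`. -/
def decryptHandler : Code :=
  branch (comp fst snd)
    (comp reduceHandler (pair fst (comp snd snd)))
    (pair fst (comp xor (pair (comp call (pair (const (bit true)) (comp fst (comp snd snd))))
      (comp snd (comp snd snd)))))

theorem sem_decryptHandler_left (ρ : Behaviour) {st m : Val} (hm : m.left.toBool = true) :
    decryptHandler.sem ρ (node st m) = .call (node (bit true) m.right.left) fun a =>
      .ret (node st (xorVal a m.right.right)) := by
  simp [decryptHandler, hm]

theorem sem_decryptHandler_right (ρ : Behaviour) {st m : Val} (hm : m.left.toBool = false) :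
    decryptHandler.sem ρ (node st m) = reduceHandler.sem ρ (node st m.right) := by
  simp [decryptHandler, hm]

theorem post_mono {s : ℕ} {α : Type} {P Q : α → Prop} (h : ∀ a, P a → Q a) {m : Comp α}
    (hm : m.Post s P) : m.Post s Q := by
  induction m with
  | ret a => exact h _ hm
  | flip k ih => exact fun b => ih b (hm b)
  | call q k ih => exact fun a ha => ih a (hm a ha)
  | tick c m ih => exact ih hm

theorem goodHandler_decryptHandler : GoodHandler decryptHandler where
  polyFor := .branch (.comp .fst .snd)
    (.comp goodHandler_reduceHandler.polyFor (.pair .fst (.comp .snd .snd)))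
    (.pair .fst (.comp .xor (.pair (.comp .call (.pair (.const _) (.comp .fst (.comp .snd .snd))))
      (.comp .snd (.comp .snd .snd)))))
  post ρ s st q := by
    cases hq : q.left.toBool
    · rw [sem_decryptHandler_right ρ hq]
      have := q.right_size_le
      exact post_mono (fun r hr => ⟨hr.1, hr.2.1, by omega⟩)
        (goodHandler_reduceHandler.post ρ s st q.right)
    · rw [sem_decryptHandler_left ρ hq]
      intro a ha
      have := size_xorVal_le a q.right.right
      simp only [Comp.Post, left_node, right_node]
      exact ⟨trivial, by omega, by omega⟩

/-- The program with a built-in key of the weak PRF that runs `reduce` on the program `T` with a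
built-in decryption key. -/
def reduceKeyed (T : Code) : Code :=
  simulation (pair (pair (pair flip snd) nil) (pair fst nil)) decryptHandler
    (bitXor snd (comp fst (comp fst fst))) T

theorem sem_reduceKeyed (ρ : Behaviour) (T : Code) (u x : Val) :
    (reduceKeyed T).sem ρ (node u x) = .flip fun b =>
      ((T.sem ρ (node u leaf)).simulate (decryptStep b x) false).bind fun r =>
        .ret (bit (r.1.toBool ^^ b)) := by
  have h (b : Bool) := Comp.simulate_of_encoding
    (fun used : Bool => node (node (bit b) x) (bit used)) (h := decryptStep b x)
    (h' := fun s m => (decryptHandler.sem ρ (node s m)).bind fun r => .ret (r.right, r.left))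
    (fun used q => by
      cases hq : q.left.toBool
      · rw [sem_decryptHandler_right ρ hq, sem_reduceHandler]
        simp only [left_node, right_node, toBool_bit, Comp.bind_assoc, Comp.ret_bind, reduceStep,
          decryptStep, hq]
        cases q.right.left.toBool <;> cases used <;> simp
      · rw [sem_decryptHandler_left ρ hq]
        simp [decryptStep, hq])
    (T.sem ρ (node u leaf)) false
  have h' (st r : Val) : (bitXor snd (comp fst (comp fst fst))).sem ρ (node st r) =
      .ret (bit (r.toBool ^^ st.left.left.toBool)) :=
    sem_bitXor (by simp) (by simp)
  simp only [reduceKeyed, simulation, sem_comp, sem_pair, sem_flip, sem_snd, sem_fst, sem_nil,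
    Comp.flip_bind, Comp.ret_bind, left_node, right_node, sem_sim]
  congr 1
  funext b
  have h := h b
  change Comp.simulate _ _ (node (node (bit b) x) leaf) = _ at h
  rw [h]
  simp only [Comp.bind_assoc, Comp.ret_bind, h', left_node, toBool_bit]

end Code

theorem erase_keyed_reduceKeyed (T : Code) (n : ℕ) (sk x : Val) :
    (keyed W.game (Code.reduceKeyed T) n sk x).erase =
      reduce (fun y => (keyed W.toCPA.game T n sk y).erase) x := by
  simp only [reduce, erase_keyed, Code.sem_reduceKeyed, Comp.simulate, Comp.flip_bind]
  congr 1
  funext b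
  simp only [Comp.simulate_bind, Comp.simulate_simulate, Comp.bind_assoc, Comp.ret_bind,
    Comp.simulate]
  have h := Comp.simulate_of_encoding (Prod.swap : Unit × Bool → Bool × Unit)
    (h := fun s q => ((keyedStep W.toCPA.game n sk s.1 q).simulate (reduceStep b x) s.2).bind
      fun r => .ret (r.1.1, (r.1.2, r.2)))
    (h' := fun s q => ((decryptStep b x s.1 q).simulate (keyedStep W.game n sk) s.2).bind
      fun r => .ret (r.1.1, (r.1.2, r.2)))
    (fun s q => by
      obtain ⟨⟨⟩, used⟩ := s
      cases hq : q.left.toBool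
      · simp only [decryptStep, keyedStep, hq, Prod.swap, reduceStep, Bool.false_eq_true, if_false,
          Comp.simulate]
        split_ifs <;> simp [Comp.simulate, keyedStep]
      · simp [decryptStep, keyedStep, hq, Comp.simulate, WMPRF.game, WMSKE.game, WMPRF.toCPA,
          xorVal_ofBits, bit])
    (T.sem noSubj (node (unary n) leaf)) ((), false)
  have h' := congrArg (fun m : Comp (Val × (Bool × Unit)) =>
    m.bind fun r => Comp.ret (bit (r.1.toBool ^^ b))) h
  simp only [Comp.bind_assoc, Comp.ret_bind] at h'
  exact h'

theorem meaningful_toCPA (h : Meaningful W.toScheme W.game) :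
    Meaningful W.toCPA.toScheme W.toCPA.game := by
  intro T hT k ⟨p, hp⟩ hk
  obtain ⟨ε, hε, H⟩ := h (Code.reduceKeyed T)
    (Code.polyFor_noSubj.1 (.simulation (.pair (.pair (.pair .flip .snd) .nil) (.pair .fst .nil))
      Code.goodHandler_decryptHandler (.bitXor .snd (.comp .fst (.comp .fst .fst)))
      (Code.polyFor_noSubj.2 hT))) (fun n => 2 * k n)
    ⟨2 * p, fun n => by simpa using hp n⟩ (fun n => by have := hk n; omega)
  refine ⟨ε, hε, fun n => le_trans (le_of_eq ?_) (H n)⟩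
  congr 2
  funext key
  simp only [funext (erase_keyed_reduceKeyed W T n key.1)]
  rfl

/-! ### Efficiency -/

theorem size_unary (n : ℕ) : (unary n).size = 2 * n + 1 := by
  induction n with
  | zero => rfl
  | succ n ih =>
    have e : (unary (n + 1)).size = 1 + (unary n).size + 1 := rfl
    omega

theorem unary_eq_ofBits (l : ℕ) : unary l = ofBits fun _ : Fin l => false := by
  simp [unary, ofBits, bit]

theorem scheme_efficient_toCPA (h : W.toScheme.Efficient) : W.toCPA.toScheme.Efficient := by
  obtain ⟨h₁, h₂, h₃, E, hE, H⟩ := h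
  refine ⟨h₁, h₂, h₃, .comp (E.subst (.blackBox .reduceCode))
    (.pair .fst (.pair (.comp .double (.comp .fst .snd)) (.comp .snd .snd))), ?_, ?_⟩
  · intro p
    obtain ⟨p₁, h₁⟩ := Code.blackBoxPolyTime_subst hE Code.realises_reduceCode p
    obtain ⟨q, hq⟩ := Code.exists_comp_withinTime
      (d := .pair .fst (.pair (.comp .double (.comp .fst .snd)) (.comp .snd .snd)))
      (.pair .fst (.pair (.comp .double (.comp .fst .snd)) (.comp .snd .snd)))
    refine ⟨q.comp (2 * Polynomial.X + 3) + 2 * p₁.comp (4 * Polynomial.X + 1),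
      fun n ρ hρ v => (hq ρ _ _ _ 1 _ (by simp) (h₁ n ρ hρ
        (node ((node leaf)^[v.left.len] v.left) v.right))).mono le_rfl ?_⟩
    simp only [Polynomial.eval_add, Polynomial.eval_mul, Polynomial.eval_X, Polynomial.eval_ofNat,
      Polynomial.eval_comp, Polynomial.eval_one]
    have e₁ := eval_mono q (show (node (unary n) v).size + 1 ≤ 2 * (n + v.size) + 3 by
      simp only [size, size_unary]; omega)
    have e₂ := eval_mono p₁ (show n + (node ((node leaf)^[v.left.len] v.left) v.right).size ≤
        4 * (n + v.size) + 1 by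
      have := v.left.len_le_size
      have := v.left_size_le
      have := v.size_left_add_right_le
      simp only [size, size_iterate_node_leaf]
      cases v
      · simp [size, len]
        omega
      · simp only [size, left_node, right_node] at *
        omega)
    omega
  · intro n k xk C
    have e : (Code.pair .fst (.pair (.comp .double (.comp .fst .snd)) (.comp .snd .snd))).sem C
        (node (unary n) (node (unary k) xk)) =
        .ret (node (unary n) (node (unary (2 * k)) xk)) := by
      simp [iterate_node_leaf_unary]
    rw [← Code.dist_sem, Code.sem_comp, e, Comp.ret_bind, Code.sem_subst, Code.dist_sem, H]
    have e' : (fun x => ((Code.blackBox Code.reduceCode).sem C x).erase) =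
        reduce fun x => (C x).erase := by
      funext x
      rw [← Code.realises_reduceCode.sem_blackBox, Code.sem, Comp.erase_erase]
    rw [e']
    rfl

/-- Encryption. -/
def encCode (lenCode evalCode : Code) : Code :=
  .comp (.pair .fst (.comp .xor (.pair
      (.comp evalCode (.pair (.comp .fst .snd) (.pair (.comp .fst (.comp .snd .snd)) .fst)))
      (.comp .snd (.comp .snd .snd)))))
    (.pair (.comp .randomBits (.comp lenCode .fst)) .id)

/-- Decryption. The first component of the ciphertext is first turned into a string of the right
length. -/
def decCode (lenCode evalCode : Code) : Code :=
  .comp .xor (.pair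
    (.comp evalCode (.pair .fst (.pair (.comp .fst .snd)
      (.comp .xor (.pair (.comp lenCode .fst) (.comp .fst (.comp .snd .snd)))))))
    (.comp .snd (.comp .snd .snd)))

theorem efficient_toCPA (h : W.Efficient) : W.toCPA.Efficient := by
  obtain ⟨h₁, ⟨cl, hcl, Hl⟩, ⟨ce, hce, He⟩⟩ := h
  refine ⟨scheme_efficient_toCPA W h₁, ⟨cl, hcl, Hl⟩, ⟨encCode cl ce, ?_, ?_⟩,
    ⟨decCode cl ce, ?_, ?_⟩⟩
  · exact Code.polyFor_noSubj.1 (.comp (.pair .fst (.comp .xor (.pair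
      (.comp (Code.polyFor_noSubj.2 hce) (.pair (.comp .fst .snd)
        (.pair (.comp .fst (.comp .snd .snd)) .fst)))
      (.comp .snd (.comp .snd .snd)))))
      (.pair (.comp .randomBits (.comp (Code.polyFor_noSubj.2 hcl) .fst)) .id))
  · rintro ⟨n, sk, m⟩
    have Hl' := Hl n
    have He' := fun x => He ⟨n, sk, x⟩
    simp only [← Code.dist_sem] at Hl' He' ⊢
    simp only [encCode, Code.sem_comp, Code.sem_pair, Code.sem_fst, Code.sem_snd, Code.sem_id,
      Comp.ret_bind, left_node, right_node, Comp.dist_bind, Hl', PMF.pure_bind, PMF.bind_bind,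
      Code.dist_randomBits, Comp.dist, PMF.bind_map, Function.comp_def, Code.sem_xor, He',
      xorVal_ofBits]
    simp only [WMPRF.toCPA] at m ⊢
    simp only [toBits_ofBits]
    rfl
  · exact Code.polyFor_noSubj.1 (.comp .xor (.pair
      (.comp (Code.polyFor_noSubj.2 hce) (.pair .fst (.pair (.comp .fst .snd)
        (.comp .xor (.pair (.comp (Code.polyFor_noSubj.2 hcl) .fst)
          (.comp .fst (.comp .snd .snd)))))))
      (.comp .snd (.comp .snd .snd))))
  · rintro ⟨n, sk, c⟩
    have Hl' := Hl n
    have He' := fun x => He ⟨n, sk, x⟩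
    simp only [← Code.dist_sem] at Hl' He' ⊢
    simp only [decCode, Code.sem_comp, Code.sem_pair, Code.sem_fst, Code.sem_snd,
      Comp.ret_bind, left_node, right_node, Comp.dist_bind, Hl', PMF.pure_bind,
      Comp.dist, Code.sem_xor, unary_eq_ofBits (W.len n), He',
      xorVal_ofBits, Bool.false_xor]
    rfl

/-! ### Correctness of extraction -/

namespace Code

/-- Runs `c`, with all its messages answered by `leaf`. -/
def isolate (c : Code) : Code := comp snd (comp (sim c leafHandler) (pair nil id))

theorem PolyFor.isolate {B : Set Behaviour} {c : Code} (hc : PolyFor B c) :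
    PolyFor B (isolate c) :=
  .comp .snd (.comp (.sim hc goodHandler_leafHandler) (.pair .nil .id))

theorem runOracle_isolate {σ : Type} (O : σ → Val → PMF (Val × σ)) (ρ : Behaviour) (c : Code)
    (v : Val) (s : σ) :
    ((isolate c).sem ρ v).runOracle O s = (c.eval ρ v).dist.map fun a => (a, s) := by
  have h : ∀ (m : Comp Val) (st : Val),
      (m.simulate (fun s _ => Comp.ret (leaf, s)) st).runOracle O s =
        m.dist.map fun a => ((a, st), s) := by
    intro m st
    induction m with
    | ret a => simp [Comp.simulate, Comp.runOracle, Comp.dist, PMF.pure_map]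
    | flip k ih => simp only [Comp.simulate, Comp.runOracle, Comp.dist, ih, PMF.map_bind]
    | call q k ih => exact ih leaf
    | tick c m ih => simpa only [Comp.simulate, Comp.runOracle, Comp.dist] using ih
  simp only [isolate, sem_comp, sem_pair, sem_nil, sem_id, Comp.ret_bind, sem_sim, right_node,
    left_node, leafHandler, sem_fst, Comp.bind_assoc, sem_snd]
  rw [Comp.runOracle_bind, h, PMF.bind_map, dist_sem]
  rfl

end Code

/-- The CPA adversary that uses a built-in key, with `evalCode` for the evaluation of the weak PRF:
it submits the challenge messages `0…0` and `10…0`, and decrypts the first bit. -/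
def decryptChallenge (evalCode : Code) : Code :=
  .comp (.bitXor (.comp .fst .fst) (.comp .fst (.comp .snd .snd)))
    (.comp (.pair (.comp (.isolate evalCode) (.pair (.comp .fst (.comp .fst .snd))
        (.pair (.comp .snd (.comp .fst .snd)) (.comp .fst .fst)))) .fst)
      (.pair (.comp .call (.const (node (bit true) (node leaf (node (bit true) leaf))))) .id))

theorem polyTime_decryptChallenge {c : Code} (hc : c.PolyTime) :
    (decryptChallenge c).PolyTime :=
  Code.polyFor_noSubj.1 (.comp (.bitXor (.comp .fst .fst) (.comp .fst (.comp .snd .snd)))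
    (.comp (.pair (.comp (.isolate (Code.polyFor_noSubj.2 hc))
      (.pair (.comp .fst (.comp .fst .snd)) (.pair (.comp .snd (.comp .fst .snd))
        (.comp .fst .fst)))) .fst) (.pair (.comp .call (.const _)) .id)))

theorem erase_exec_hardwire (T : Code) (n : ℕ) (w x : Val) :
    ((hardwire T n w).exec x).erase = T.sem noSubj (node (node (unary n) w) x) := by
  simp only [hardwire, exec, left_node, right_node, Code.decode_encode]
  rfl

theorem left_toBool_ofBits {l : ℕ} (hl : 0 < l) (y : Fin l → Bool) :
    (ofBits y).left.toBool = y ⟨0, hl⟩ := by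
  cases l with
  | zero => exact absurd hl (lt_irrefl 0)
  | succ l => simp [ofBits, List.ofFn_succ, ofList]

/-- Decryption with a key that agrees with `sk` on most inputs wins the CPA game. -/
theorem prob_win_decryptChallenge {c : Code}
    (hc : ∀ (n : ℕ) (sk : Val) (x : Fin (W.len n) → Bool),
      (c.eval noSubj (node (unary n) (node sk (ofBits x)))).dist =
        PMF.pure (ofBits (W.eval n sk x))) (n : ℕ) (sk sk' : Val) :
    prob ((uniformBits (W.len n)).map fun x => W.eval n sk' x = W.eval n sk x) ≤
      prob (W.toCPA.game.win n sk (hardwire (decryptChallenge c) n sk').exec) := by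
  have key : W.toCPA.game.win n sk (hardwire (decryptChallenge c) n sk').exec =
      (PMF.uniformOfFintype Bool).bind fun b => (uniformBits (W.len n)).map fun x =>
        ((ofBits (W.eval n sk' x)).left.toBool ^^
          (ofBits fun i => W.eval n sk x i ^^ toBits (W.len n)
            (if b then node (bit true) leaf else leaf) i).left.toBool) = b := by
    rw [← win_erase_toCPA]
    simp only [erase_exec_hardwire, WMSKE.game, WMSKE.experiment, PMF.map_bind]
    congr 1
    funext b
    have hbit : ∀ (ρ : Behaviour) (v : Val),
        (Code.bitXor (.comp .fst .fst) (.comp .fst (.comp .snd .snd))).sem ρ v =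
          .ret (bit (v.left.left.toBool ^^ v.right.right.left.toBool)) := fun ρ v =>
      Code.sem_bitXor (by simp) (by simp)
    simp only [decryptChallenge, Code.sem_comp, Code.sem_pair, Code.sem_const, Code.sem_id,
      Code.sem_call, Code.sem_fst, Code.sem_snd, Comp.ret_bind, Comp.call_bind, Comp.runOracle,
      left_node, right_node, Comp.bind_assoc, hbit, Comp.runOracle_bind, Code.runOracle_isolate,
      WMSKE.challenger, toBool_bit, Bool.true_eq_false, if_false, Bool.false_eq_true,
      PMF.bind_map, Function.comp_def, PMF.map_bind, PMF.pure_map, encVal_toCPA, WMPRF.sample,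
      encAnswer, PMF.map_comp, hc, PMF.pure_bind, xorVal_ofBits]
    rfl
  rw [key, prob_uniform_bool, le_div_iff₀ two_pos, mul_two]
  have h : ∀ b : Bool, prob ((uniformBits (W.len n)).map fun x => W.eval n sk' x = W.eval n sk x) ≤
      prob ((uniformBits (W.len n)).map fun x => ((ofBits (W.eval n sk' x)).left.toBool ^^
        (ofBits fun i => W.eval n sk x i ^^ toBits (W.len n)
          (if b then node (bit true) leaf else leaf) i).left.toBool) = b) := by
    refine fun b => prob_map_mono _ _ _ fun x _ hx => ?_
    rw [hx, left_toBool_ofBits (W.len_pos n), left_toBool_ofBits (W.len_pos n)]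
    cases b <;> simp [toBits]
  exact add_le_add (h false) (h true)

theorem exists_mem_forall_le_two_mul {S : Set Val} (hS : S.Nonempty) (u : Val → ℝ) (h₀ : ∀ τ, 0 ≤ u τ)
    (h₁ : ∀ τ, u τ ≤ 1) : ∃ τ ∈ S, ∀ τ' ∈ S, u τ' ≤ 2 * u τ := by
  have hb : BddAbove (u '' S) := ⟨1, by rintro _ ⟨τ, -, rfl⟩; exact h₁ τ⟩
  by_cases hs : sSup (u '' S) ≤ 0
  · obtain ⟨τ, hτ⟩ := hS
    refine ⟨τ, hτ, fun τ' hτ' => ?_⟩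
    have := le_csSup hb ⟨τ', hτ', rfl⟩
    linarith [h₀ τ]
  · obtain ⟨_, ⟨τ, hτ, rfl⟩, h⟩ := exists_lt_of_lt_csSup (hS.image u)
      (show sSup (u '' S) / 2 < sSup (u '' S) by linarith)
    refine ⟨τ, hτ, fun τ' hτ' => ?_⟩
    have := le_csSup hb ⟨τ', hτ', rfl⟩
    linarith

/-- A distribution that is computed in polynomial time has short values. -/
theorem PPTComputable.exists_size_le {ι : Type} {input : ι → Val} {f : ι → PMF Val}
    (h : PPTComputable input f) :
    ∃ p : Polynomial ℕ, ∀ i, ∀ v ∈ (f i).support, v.size ≤ p.eval ((input i).size + 1) := by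
  obtain ⟨c, ⟨p, hp⟩, H⟩ := h
  exact ⟨p, fun i v hv => (hp 1 (input i)).bdd.of_mem_support le_rfl (H i ▸ hv)⟩

/-- Marked keys have polynomial length. -/
theorem exists_size_mark_le {S : Scheme} (h : S.Efficient) :
    ∃ p : Polynomial ℕ, ∀ n, ∀ key ∈ (S.setup n).support, ∀ τ ∈ S.marks n,
      ∀ skt ∈ (S.mark n key.2.2 key.1 τ).support, skt.size ≤ p.eval n := by
  obtain ⟨⟨p₁, h₁⟩, h₂, h₃, -⟩ := h
  obtain ⟨p₂, h₂⟩ := h₂.exists_size_le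
  obtain ⟨p₃, h₃⟩ := h₃.exists_size_le
  refine ⟨p₃.comp (2 * Polynomial.X + 5 + 2 * p₂.comp (2 * Polynomial.X + 2) + p₁),
    fun n key hkey τ hτ skt hskt => (h₃ ⟨(n, key.2.2, key.1, τ), hτ⟩ skt hskt).trans ?_⟩
  have e₁ := h₁ n τ hτ
  have e₂ := h₂ n (node key.1 (node key.2.1 key.2.2)) (by
    rw [PMF.support_map]
    exact ⟨key, hkey, rfl⟩)
  simp only [size, size_unary] at e₂
  rw [show 2 * n + 1 + 1 = 2 * n + 2 from rfl] at e₂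
  simp only [Polynomial.eval_comp, Polynomial.eval_add, Polynomial.eval_mul, Polynomial.eval_X,
    Polynomial.eval_ofNat]
  refine eval_mono p₃ ?_
  simp only [size, size_unary]
  omega

/-- The adversary that has the mark `τ n` put into the key, and outputs the program `T` with the
marked key. -/
def markingAdversary (T : Code) (τ : ℕ → Val) (hτ : PolyBounded fun n => (τ n).size) :
    Adversary where
  code := .pair (.const T.encode) (.pair (.comp .fst .fst) (.comp .call (.comp .snd .fst)))
  polyTime := Code.polyFor_noSubj.1
    (.pair (.const _) (.pair (.comp .fst .fst) (.comp .call (.comp .snd .fst))))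
  advice := τ
  advice_poly := hτ

theorem runOracle_markingAdversary (T : Code) (τ : ℕ → Val)
    (hτ : PolyBounded fun n => (τ n).size) (S : Scheme) (q : ℕ → ℕ∞) (hq : ∀ n, 1 ≤ q n) (n : ℕ)
    (mk sk aux : Val) (h : τ n ∈ S.marks n) :
    ((markingAdversary T τ hτ).run n aux).runOracle (markOracle S q n mk sk) [] =
      (S.mark n mk sk (τ n)).map fun skt => (hardwire T n skt, [τ n]) := by
  rw [Adversary.runOracle_run]
  have hq' : 0 < q n := lt_of_lt_of_le one_pos (hq n)
  simp only [markingAdversary, Code.sem_comp, Code.sem_pair, Code.sem_const, Code.sem_fst,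
    Code.sem_snd, Code.sem_call, Comp.ret_bind, Comp.call_bind, Comp.runOracle, left_node,
    right_node, markOracle, h, List.length_nil, Nat.cast_zero, hq', and_self, if_true,
    PMF.bind_map, Function.comp_def]
  rfl

/-- The event that the program `T` with a key marked by `τ` contradicts unremovability. -/
def markLost (S : Scheme) (G : Game) (T : Code) (p : Polynomial ℕ) (n k : ℕ) (τ : Val)
    (key : Val × Val × Val) (skt : Val) : PMF Prop :=
  (S.extract n k key.2.1 fun x => ((hardwire T n skt).exec x).erase).map fun out =>
    (¬ ∃ τ' ∈ [τ], out = some τ') ∧ Bounded (hardwire T n skt).exec p n ∧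
      Good G n k key.1 (hardwire T n skt).exec

/-- Unremovability gives one bound for all marks, since the advice of an adversary can be a mark that
is lost almost most often. -/
theorem Unremovable.exists_markLost_le {S : Scheme} {G : Game} {pub : Bool} {q : ℕ → ℕ∞}
    {k : ℕ → ℕ} (h : Unremovable S G pub q k) (hq : ∀ n, 1 ≤ q n)
    (hS : ∃ p : Polynomial ℕ, ∀ n, ∀ τ ∈ S.marks n, τ.size ≤ p.eval n) (T : Code)
    (p : Polynomial ℕ) :
    ∃ δ, Negligible δ ∧ ∀ n, ∀ τ ∈ S.marks n,
      prob ((S.setup n).bind fun key => (S.mark n key.2.2 key.1 τ).bind fun skt =>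
        markLost S G T p n (k n) τ key skt) ≤ δ n := by
  obtain ⟨pτ, hpτ⟩ := hS
  let u : ℕ → Val → ℝ := fun n τ => prob ((S.setup n).bind fun key =>
    (S.mark n key.2.2 key.1 τ).bind fun skt => markLost S G T p n (k n) τ key skt)
  have hex : ∀ n, ∃ τ, τ.size ≤ pτ.eval n + 1 ∧ (∀ τ' ∈ S.marks n, τ ∈ S.marks n) ∧
      ∀ τ' ∈ S.marks n, u n τ' ≤ 2 * u n τ := by
    intro n
    by_cases hn : (S.marks n).Nonempty
    · obtain ⟨τ, hτ, h⟩ := exists_mem_forall_le_two_mul hn (u n) (fun _ => prob_nonneg _)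
        (fun _ => prob_le_one _)
      exact ⟨τ, (hpτ n τ hτ).trans (by omega), fun _ _ => hτ, h⟩
    · rw [Set.not_nonempty_iff_eq_empty] at hn
      exact ⟨leaf, by simp [size], by simp [hn], by simp [hn]⟩
  choose τ hτs hτm hτu using hex
  have hτp : PolyBounded fun n => (τ n).size := ⟨pτ + 1, by simpa using hτs⟩
  obtain ⟨δ, hδ, Hδ⟩ := h (markingAdversary T τ hτp) p
  refine ⟨fun n => 2 * δ n, hδ.const_mul 2, fun n σ hσ => (hτu n σ hσ).trans
    (mul_le_mul_of_nonneg_left (le_trans (le_of_eq ?_) (Hδ n)) zero_le_two)⟩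
  refine congrArg (fun f => prob ((S.setup n).bind f)) (funext fun key => ?_)
  rw [runOracle_markingAdversary T τ hτp S q hq n _ _ _ (hτm n σ hσ), PMF.bind_map]
  rfl

/-- A marked key agrees with the original one on most inputs: the functionality property holds on
average over the inputs. -/
theorem le_prob_agree {n : ℕ} {τ : Val} {ε : ℝ}
    (h : ∀ x : Fin (W.len n) → Bool, 1 - ε ≤ prob ((W.setup n).bind fun key =>
      (W.mark n key.2.2 key.1 τ).map fun skt => W.eval n skt x = W.eval n key.1 x)) :
    1 - ε ≤ prob ((W.setup n).bind fun key => (W.mark n key.2.2 key.1 τ).bind fun skt =>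
      (uniformBits (W.len n)).map fun x => W.eval n skt x = W.eval n key.1 x) := by
  have e : ((W.setup n).bind fun key => (W.mark n key.2.2 key.1 τ).bind fun skt =>
      (uniformBits (W.len n)).map fun x => W.eval n skt x = W.eval n key.1 x) =
      (uniformBits (W.len n)).bind fun x => (W.setup n).bind fun key =>
        (W.mark n key.2.2 key.1 τ).map fun skt => W.eval n skt x = W.eval n key.1 x := by
    simp only [PMF.map]
    rw [PMF.bind_comm]
    congr 1
    funext key
    rw [PMF.bind_comm]
    rfl
  rw [e]
  have := prob_bind_le (uniformBits (W.len n)) (fun _ => PMF.pure True)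
    (fun x => (W.setup n).bind fun key =>
      (W.mark n key.2.2 key.1 τ).map fun skt => W.eval n skt x = W.eval n key.1 x)
    (fun _ => PMF.pure True) 1 0 ε (fun x _ => by
      have := h x
      rw [prob_pure_of trivial]
      linarith)
  rw [PMF.bind_const, prob_pure_of trivial] at this
  linarith

theorem exists_bounded_hardwire {T : Code} (hT : T.PolyTime) (p : Polynomial ℕ) :
    ∃ p' : Polynomial ℕ, ∀ n (w : Val), w.size ≤ p.eval n →
      Bounded (hardwire T n w).exec p' n := by
  obtain ⟨pT, hpT⟩ := hT
  refine ⟨pT.comp (3 * Polynomial.X + p + 3), fun n w hw s x hx => ?_⟩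
  have e : (hardwire T n w).exec x = T.eval noSubj (node (node (unary n) w) x) := by
    simp only [hardwire, exec, left_node, right_node, Code.decode_encode]
  rw [e]
  refine (hpT s _).mono le_rfl ?_
  simp only [Polynomial.eval_comp, Polynomial.eval_add, Polynomial.eval_mul,
    Polynomial.eval_X, Polynomial.eval_ofNat]
  refine eval_mono pT ?_
  have := eval_mono p (show n ≤ n + s by omega)
  simp only [size, size_unary]
  omega

/-- If the marked key agrees with the original one on a fraction of at least `5 / 6` of the inputs,
then the program `decryptChallenge` is good for all `k > 2`, so that its mark is extracted or
lost. -/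
theorem prob_agree_le {c : Code}
    (hc : ∀ (n : ℕ) (sk : Val) (x : Fin (W.len n) → Bool),
      (c.eval noSubj (node (unary n) (node sk (ofBits x)))).dist =
        PMF.pure (ofBits (W.eval n sk x))) {p : Polynomial ℕ} {n k : ℕ} (hk : 2 < k) (τ : Val)
    (key : Val × Val × Val) (skt : Val)
    (hB : Bounded (hardwire (decryptChallenge c) n skt).exec p n) :
    prob ((uniformBits (W.len n)).map fun x => W.eval n skt x = W.eval n key.1 x) ≤
      1 / 6 * prob ((W.toCPA.extract n k key.2.1
        fun x => ((hardwire (decryptChallenge c) n skt).exec x).erase).map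
          fun out => out = some τ) +
      1 / 6 * prob (markLost W.toCPA.toScheme W.toCPA.game (decryptChallenge c) p n k τ key skt) +
      5 / 6 := by
  have h₀ := prob_nonneg ((W.toCPA.extract n k key.2.1
    fun x => ((hardwire (decryptChallenge c) n skt).exec x).erase).map fun out => out = some τ)
  have h₀' := prob_nonneg
    (markLost W.toCPA.toScheme W.toCPA.game (decryptChallenge c) p n k τ key skt)
  by_cases hG : Good W.toCPA.game n k key.1 (hardwire (decryptChallenge c) n skt).exec
  · have h₁ : 1 ≤ 1 * prob ((W.toCPA.extract n k key.2.1
        fun x => ((hardwire (decryptChallenge c) n skt).exec x).erase).map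
          fun out => out = some τ) +
        1 * prob (markLost W.toCPA.toScheme W.toCPA.game (decryptChallenge c) p n k τ key skt) +
        0 := by
      have := prob_bind_le (W.toCPA.extract n k key.2.1
          fun x => ((hardwire (decryptChallenge c) n skt).exec x).erase)
        (fun _ => PMF.pure True) (fun out => PMF.pure (out = some τ))
        (fun out => PMF.pure ((¬ ∃ τ' ∈ [τ], out = some τ') ∧
              Bounded (hardwire (decryptChallenge c) n skt).exec p n ∧
              Good W.toCPA.game n k key.1 (hardwire (decryptChallenge c) n skt).exec))
        1 1 0 (fun out _ => by
          rw [prob_pure_of trivial]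
          by_cases ho : out = some τ
          · have := prob_nonneg (PMF.pure ((¬ ∃ τ' ∈ [τ], out = some τ') ∧
              Bounded (hardwire (decryptChallenge c) n skt).exec p n ∧
              Good W.toCPA.game n k key.1 (hardwire (decryptChallenge c) n skt).exec))
            rw [prob_pure_of ho]
            linarith
          · rw [prob_pure_of_not ho, prob_pure_of ⟨by simpa using ho, hB, hG⟩]
            norm_num)
      rw [PMF.bind_const, prob_pure_of trivial] at this
      exact this
    have h₂ := prob_le_one
      ((uniformBits (W.len n)).map fun x => W.eval n skt x = W.eval n key.1 x)
    linarith
  · have h₁ := prob_win_decryptChallenge W hc n key.1 skt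
    have h₂ : prob (W.toCPA.game.win n key.1 (hardwire (decryptChallenge c) n skt).exec) <
        1 / 2 + 1 / (k : ℝ) := not_le.1 hG
    have h₃ : 1 / (k : ℝ) ≤ 1 / 3 :=
      one_div_le_one_div_of_le (by norm_num) (by exact_mod_cast hk)
    linarith

/-- A marked key decrypts like the original one, so the program that uses it in the CPA game is
good, and by unremovability its mark is extracted. This is the only step that needs a marking
query. -/
theorem extractionCorrect_toCPA (pub : Bool) (q : ℕ → ℕ∞) (hq : ∀ n, 1 ≤ q n)
    (he : W.Efficient) (hf : W.FunctionalityPreserving)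
    (hu : StronglyUnremovable W.toCPA.toScheme W.toCPA.game pub q) :
    ExtractionCorrect W.toCPA.toScheme := by
  obtain ⟨hS, -, ⟨ce, hce, He⟩⟩ := he
  have hT := polyTime_decryptChallenge hce
  refine ⟨decryptChallenge ce, hT, fun k hk hk2 => ?_⟩
  obtain ⟨ε, hε, Hf⟩ := hf
  obtain ⟨pm, hpm⟩ := exists_size_mark_le hS
  obtain ⟨p, hp⟩ := exists_bounded_hardwire hT pm
  obtain ⟨δ, hδ, Hδ⟩ := (hu k hk (fun n => zero_lt_two.trans (hk2 n))).exists_markLost_le hq hS.1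
    (decryptChallenge ce) p
  refine ⟨fun n => 6 * ε n + δ n, (hε.const_mul 6).add hδ, fun n σ hσ => ?_⟩
  have h₁ := (le_prob_agree W fun x => Hf n x σ hσ).trans
    (prob_bind_le (W.setup n) _ _ _ _ _ _ fun key hkey =>
      prob_bind_le (W.mark n key.2.2 key.1 σ) _ _ _ _ _ _ fun skt hskt =>
        prob_agree_le W (fun n sk x => He ⟨n, sk, x⟩) (hk2 n) σ key skt
          (hp n skt (hpm n key hkey σ hσ skt hskt)))
  have h₂ := Hδ n σ hσ
  have h₃ : 1 - (6 * ε n + δ n) ≤ prob ((W.setup n).bind fun key =>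
      (W.mark n key.2.2 key.1 σ).bind fun skt =>
        (W.toCPA.extract n (k n) key.2.1
          fun x => ((hardwire (decryptChallenge ce) n skt).exec x).erase).map
            fun out => out = some σ) := by
    have h₂' : prob ((W.setup n).bind fun key => (W.mark n key.2.2 key.1 σ).bind fun skt =>
      markLost W.toCPA.toScheme W.toCPA.game (decryptChallenge ce) p n (k n) σ key skt) ≤ δ n := h₂
    linarith
  exact h₃

end WM

end

theorem mainTheorem3 (W : WM.WMPRF) (pub : Bool) (q : ℕ → ℕ∞) (hq : ∀ n, 1 ≤ q n)
    (quality : WM.SimQuality) :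
    (W.Secure pub q quality → W.toCPA.Secure pub q quality) ∧
    (∀ k : ℕ → ℕ, WM.Unremovable W.toScheme W.game pub q (fun n => 2 * k n) →
      WM.Unremovable W.toCPA.toScheme W.toCPA.game pub q k) ∧
    (WM.Meaningful W.toScheme W.game →
      WM.Meaningful W.toCPA.toScheme W.toCPA.game) := by
  refine ⟨fun ⟨he, hf, _, hg, hu, hs⟩ => ?_, WM.unremovable_toCPA W pub q,
    WM.meaningful_toCPA W⟩
  have hu' : WM.StronglyUnremovable W.toCPA.toScheme W.toCPA.game pub q :=
    fun k ⟨p, hp⟩ hk => WM.unremovable_toCPA W pub q k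
      (hu (fun n => 2 * k n) ⟨2 * p, fun n => by simpa using hp n⟩
        fun n => Nat.mul_pos two_pos (hk n))
  exact ⟨WM.efficient_toCPA W he, WM.functionalityPreserving_toCPA W hf,
    WM.extractionCorrect_toCPA W pub q hq he hf hu', WM.gameSecure_toCPA W pub hg, hu',
    WM.keySimulation_toCPA W pub quality hs⟩
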